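/- Let $\beta>1$ be a real number and let $\mathfrak d\ni 0$ be a finite set of nonnegative real numbers with $|\mathfrak d|\ge 2$. For $\lambda\in\mathbb R$ let $r(\lambda)$ be the number of sequences $(\delta_k)_{k\ge 0}\in\mathfrak d^{\mathbb N_0}$ with $\sum_{k\ge 0}\delta_k\beta^k=\lambda$, and, for $\Re(s)>D:=\log_\beta|\mathfrak d|$, let $$\zeta(s)=\sum_{\lambda>0}\frac{r(\lambda)}{\lambda^{s}}$$ (the series converges absolutely there). Put $L(y)=\log\sum_{\delta\in\mathfrak d}e^{-\delta y}$ and $$P(w)=\sum_{k\in\mathbb Z}\Big(k+w+\tfrac12\Big)\big(L(\beta^{k+w})-L(\beta^{k+1+w})\big)+\tfrac12\log|\mathfrak d|\qquad(w\in\mathbb R),$$ let $c(\ell)$, $\ell\ge 0$, be the Taylor coefficients at $t=0$ of $\prod_{k\ge 1}\dfrac{|\mathfrak d|}{\sum_{\delta\in\mathfrak d}e^{-\delta\beta^{-k}t}}$, let $\sigma$ be the radius of convergence of $\sum_{\ell\ge0}c(\ell)t^\ell$, and let $\rho=\min\{h\in\mathbb N_0:\beta^{-h}<\sigma\}$. For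 $w>0$ let $\Gamma(s,w)=\int_w^\infty e^{-u}u^{s-1}\,du$, and read $1/\Gamma(-n)$ as $0$ for $n\in\mathbb N_0$. Then $\zeta$ continues to a meromorphic function on $\mathbb C$ which is holomorphic except for at most simple poles at the points $$p_{j,k}=D-j-\frac{2\pi i k}{\log\beta}\qquad(j\in\mathbb N_0,\ k\in\mathbb Z).$$ For every integer $c\ge\rho$ and every $s\in\mathbb C$ that is none of the points $p_{j,k}$, $$\zeta(s)=\frac1{\Gamma(s)}\sum_{\lambda>0}\frac{r(\lambda)}{\lambda^s}\Gamma(s,\lambda\beta^{-c})-\frac{\beta^{-cs}}{\Gamma(s+1)}+\frac1{\Gamma(s)}\sum_{\ell\ge0}\frac{\beta^{-(s+\ell-D)c}\log\beta}{\beta^{s+\ell-D}-1}\,c(\ell)\int_0^1e^{P(u)}\beta^{(s+\ell-D)u}\,du,$$ where both series converge absolutely. The residues are $$\operatorname*{Res}_{s=p_{j,k}}\zeta(s)=\frac{c(j)}{\Gamma(p_{j,k})}\int_0^1e^{P(u)}e^{-2\pi iku}\,du .$$ Moreover, $\zeta$ is holomorphic at $0,-1,-2,\dots$. If $D\notin\mathbb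 N$, then $\zeta(0)=-1$ and $\zeta(-n)=0$ for all integers $n\ge1$. If $D\in\mathbb N$, then for all integers $n\ge0$ $$\zeta(-n)=(-1)^n\,n!\;c(n+D)\int_0^1e^{P(u)}\,du-\mathbf 1_{n=0}.$$ -/

import Mathlib

namespace NumerationZeta

/-- The number `r(x)` of digit sequences `(δ₀, δ₁, …)` in `d` with `∑ δ_k b_k = x`. (The set is
finite when all `b_k > 0`, `b_k → ∞` and the digits are nonnegative and include `0`.) -/
noncomputable def repCount (b : ℕ → ℝ) (d : Finset ℝ) (x : ℝ) : ℕ :=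
  Set.ncard {δ : ℕ → d | HasSum (fun k => (δ k : ℝ) * b k) x}

/-- The term of the zeta function `∑_{x > 0} r(x) / x ^ s` at the real number `x > 0`. -/
noncomputable def zetaTerm (b : ℕ → ℝ) (d : Finset ℝ) (s : ℂ) (x : Set.Ioi (0 : ℝ)) : ℂ :=
  (repCount b d (x : ℝ) : ℂ) / ((x : ℝ) : ℂ) ^ s

/-- `L_d(y) = log ∑_{δ ∈ d} e^{-δ y}`. -/
noncomputable def logDigitSum (d : Finset ℝ) (y : ℝ) : ℝ :=
  Real.log (∑ δ ∈ d, Real.exp (-δ * y))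

/-- The `1`-periodic function `P_{β,d}`. -/
noncomputable def periodicP (β : ℝ) (d : Finset ℝ) (w : ℝ) : ℝ :=
  (∑' k : ℤ, ((k : ℝ) + w + 1 / 2) *
      (logDigitSum d (β ^ ((k : ℝ) + w)) - logDigitSum d (β ^ ((k : ℝ) + 1 + w)))) +
    1 / 2 * Real.log (d.card : ℝ)

/-- The product `∏_{k ≥ 1} |d| / ∑_{δ ∈ d} e^{-δ β^{-k} t}`, which is convergent and analytic near
`t = 0`; the index `k` of the code starts at `0`. -/
noncomputable def digitProduct (β : ℝ) (d : Finset ℝ) (t : ℂ) : ℂ :=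
  ∏' k : ℕ, (d.card : ℂ) / ∑ δ ∈ d, Complex.exp (-(δ : ℂ) * ((β : ℂ) ^ (k + 1))⁻¹ * t)

/-- The Taylor coefficients `c_{β,d}(ℓ)` of `digitProduct` at `0`. -/
noncomputable def taylorCoeff (β : ℝ) (d : Finset ℝ) (l : ℕ) : ℂ :=
  iteratedDeriv l (digitProduct β d) 0 / (l.factorial : ℂ)

/-- The radius of convergence of `∑ c_{β,d}(ℓ) t^ℓ`: the largest `σ` such that this power series
converges absolutely for all `|t| < σ`. -/
noncomputable def convRadius (β : ℝ) (d : Finset ℝ) : ENNReal :=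
  (FormalMultilinearSeries.ofScalars ℂ (taylorCoeff β d)).radius

/-- The least integer `h ≥ 0` with `β^{-h} < σ`. -/
noncomputable def rho (β : ℝ) (d : Finset ℝ) : ℕ :=
  sInf {h : ℕ | ENNReal.ofReal ((β ^ h)⁻¹) < convRadius β d}

/-- The upper incomplete gamma function `Γ(s, w) = ∫_w^∞ e^{-u} u^{s-1} du`, for `w > 0`. -/
noncomputable def upperGamma (s : ℂ) (w : ℝ) : ℂ :=
  ∫ u in Set.Ioi w, (Real.exp (-u) : ℂ) * (u : ℂ) ^ (s - 1)

/-- The `ℓ`-th term, with `D = log_β |d|` and `z = s + ℓ - D`,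
`β^{-z c} (log β) / (β^z - 1) * c_{β,d}(ℓ) * ∫_0^1 e^{P(u)} β^{z u} du`. -/
noncomputable def mellinTerm (β : ℝ) (d : Finset ℝ) (c : ℕ) (s : ℂ) (l : ℕ) : ℂ :=
  (β : ℂ) ^ (-(s + l - (Real.logb β d.card : ℂ)) * c) * (Real.log β : ℂ) /
      ((β : ℂ) ^ (s + l - (Real.logb β d.card : ℂ)) - 1) *
    taylorCoeff β d l *
    ∫ u in (0 : ℝ)..1, (Real.exp (periodicP β d u) : ℂ) *
      (β : ℂ) ^ ((s + l - (Real.logb β d.card : ℂ)) * u)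

/-- The point `log_β |d| - j - 2 π i k / log β`. -/
noncomputable def polePoint (β : ℝ) (d : Finset ℝ) (j : ℕ) (k : ℤ) : ℂ :=
  (Real.logb β d.card : ℂ) - j - 2 * Real.pi * k * Complex.I / Real.log β

end NumerationZeta

open Filter Topology MeasureTheory

namespace NumerationZeta

/-! Write G(t) = ∑_{δ∈d} e^{-δt} and let F(t) = ∑ e^{-λt} run over all finitely supported digit
sequences, λ being the value. Splitting off the lowest digit, λ = a + βλ', gives F(t) = G(t)F(βt)
(`seqGF_eq_mul`), hence F(t) = ∏_{k≥0} G(β^k t). With H(t) = ∏_{k≥1} |d|/G(β^{-k}t), Abel summation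
in the definition of P yields F(t) = t^{-D} e^{P(log_β t)} H(t) (`seqGF_eq`): a power, a
log-periodic factor and a factor analytic at 0.

For Re s > D, Γ(s)ζ(s) is the Mellin integral of F - 1. It is cut at ε = β^{-c}. The part above ε is
the incomplete Gamma series, entire in s. Below ε, the -1 gives an elementary term, and F is
expanded by the Taylor series of H, which represents H on the whole interval (0, σ)
(`hasSum_taylorCoeff`). Each integral of e^{P(log_β t)} t^{z-1} with z = s + ℓ - D is then computed
from its self-similarity under t ↦ t/β, which produces the denominator β^z - 1
(`integral_logPeriodicPow`). This is the explicit formula for Re s > D (`zetaSum_eq`).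

Its right-hand side converges locally uniformly away from the points with β^z = 1
(`exists_mellinTail_bound`), so it is the continuation. Since |β^z| = 1 fixes Re z, at each point at
most one denominator vanishes, and it does so to first order; hence the simple poles and residues
(`exists_zetaCont_eq_near_pole`). At a nonpositive integer the zero of 1/Γ cancels the pole, and the
value comes from the derivative of 1/Γ and from the elementary term (`zetaMero_neg_nat_of_pole`). -/

/-! ### Digit sequences and their values -/

/-- A finite set of at least two nonnegative digits, one of which is `0`. -/
structure IsDigitSet (d : Finset ℝ) : Prop where
  zero_mem : (0 : ℝ) ∈ d
  nonneg : ∀ δ ∈ d, 0 ≤ δ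
  two_le_card : 2 ≤ d.card

/-- Digit sequences with only finitely many nonzero digits. -/
def DigitSeq (d : Finset ℝ) : Type :=
  {δ : ℕ → d // ∀ᶠ k in atTop, ((δ k : d) : ℝ) = 0}

namespace DigitSeq

variable {d : Finset ℝ} {β : ℝ}

/-- The number represented by a digit sequence in base `β`. -/
noncomputable def value (β : ℝ) (δ : DigitSeq d) : ℝ := ∑' k, (δ.1 k : ℝ) * β ^ k

theorem summable (β : ℝ) (δ : DigitSeq d) : Summable fun k => (δ.1 k : ℝ) * β ^ k := by
  obtain ⟨n, hn⟩ := eventually_atTop.1 δ.2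
  refine summable_of_ne_finset_zero (s := Finset.range n) fun k hk => ?_
  rw [hn k (by simpa using hk), zero_mul]

/-- Splitting off the lowest digit. -/
def consEquiv (d : Finset ℝ) : d × DigitSeq d ≃ DigitSeq d where
  toFun p := ⟨fun k => Nat.casesOn k p.1 p.2.1, by
    obtain ⟨n, hn⟩ := eventually_atTop.1 p.2.2
    refine eventually_atTop.2 ⟨n + 1, fun k hk => ?_⟩
    obtain ⟨k, rfl⟩ : ∃ j, k = j + 1 := ⟨k - 1, by omega⟩
    exact hn k (by omega)⟩
  invFun δ := (δ.1 0, ⟨fun k => δ.1 (k + 1), (tendsto_add_atTop_nat 1).eventually δ.2⟩)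
  left_inv p := rfl
  right_inv δ := by
    apply Subtype.ext
    funext k
    cases k <;> rfl

theorem value_consEquiv (β : ℝ) (p : d × DigitSeq d) :
    (consEquiv d p).value β = p.1 + β * p.2.value β := by
  have h : (consEquiv d p).value β = (p.1 : ℝ) * β ^ 0 + ∑' k, (p.2.1 k : ℝ) * β ^ (k + 1) :=
    ((consEquiv d p).summable β).tsum_eq_zero_add
  rw [h, value, ← tsum_mul_left, pow_zero, mul_one]
  congr 1
  exact tsum_congr fun k => by ring

theorem value_nonneg (hd : IsDigitSet d) (hβ : 1 < β) (δ : DigitSeq d) : 0 ≤ δ.value β :=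
  tsum_nonneg fun k => mul_nonneg (hd.nonneg _ (δ.1 k).2) (by positivity)

theorem digit_le_value (hd : IsDigitSet d) (hβ : 1 < β) (δ : DigitSeq d) (k : ℕ) :
    (δ.1 k : ℝ) ≤ δ.value β :=
  (le_mul_of_one_le_right (hd.nonneg _ (δ.1 k).2) (one_le_pow₀ hβ.le)).trans
    ((δ.summable β).le_tsum k fun j _ => mul_nonneg (hd.nonneg _ (δ.1 j).2) (by positivity))

/-- The sequence of zeros. -/
def zero (hd : IsDigitSet d) : DigitSeq d :=
  ⟨fun _ => ⟨0, hd.zero_mem⟩, Eventually.of_forall fun _ => rfl⟩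

theorem value_zero (hd : IsDigitSet d) : (zero hd).value β = 0 := by
  simp [value, zero]

theorem eq_zero_of_value_eq_zero (hd : IsDigitSet d) (hβ : 1 < β) {δ : DigitSeq d}
    (h : δ.value β = 0) : δ = zero hd :=
  Subtype.ext <| funext fun k => Subtype.ext <|
    le_antisymm ((digit_le_value hd hβ δ k).trans h.le) (hd.nonneg _ (δ.1 k).2)

theorem value_pos_iff (hd : IsDigitSet d) (hβ : 1 < β) {δ : DigitSeq d} :
    0 < δ.value β ↔ δ ≠ zero hd := by
  refine ⟨fun h h' => ?_, fun h => ?_⟩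
  · rw [h', value_zero] at h
    exact lt_irrefl _ h
  · exact lt_of_le_of_ne (value_nonneg hd hβ δ) fun h' =>
      h (eq_zero_of_value_eq_zero hd hβ h'.symm)

end DigitSeq

theorem IsDigitSet.exists_pos_le {d : Finset ℝ} (hd : IsDigitSet d) :
    ∃ m : ℝ, 0 < m ∧ ∀ δ ∈ d, δ ≠ 0 → m ≤ δ := by
  have hne : (d.erase 0).Nonempty := by
    rw [← Finset.card_pos, Finset.card_erase_of_mem hd.zero_mem]
    have := hd.two_le_card
    omega
  refine ⟨(d.erase 0).min' hne, ?_, fun δ h h0 => Finset.min'_le _ _ (by simp [h, h0])⟩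
  have := Finset.min'_mem _ hne
  rw [Finset.mem_erase] at this
  exact lt_of_le_of_ne (hd.nonneg _ this.2) this.1.symm

namespace DigitSeq

variable {d : Finset ℝ} {β : ℝ}

theorem exists_pos_le_value (hd : IsDigitSet d) (hβ : 1 < β) :
    ∃ m : ℝ, 0 < m ∧ ∀ δ : DigitSeq d, 0 < δ.value β → m ≤ δ.value β := by
  obtain ⟨m, hm, h⟩ := hd.exists_pos_le
  refine ⟨m, hm, fun δ hδ => ?_⟩
  have : ∃ k, (δ.1 k : ℝ) ≠ 0 := by
    by_contra! hk
    simp [value, hk] at hδ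
  obtain ⟨k, hk⟩ := this
  exact (h _ (δ.1 k).2 hk).trans (digit_le_value hd hβ δ k)

/-! ### Convergence of sums over digit sequences -/

/-- The digit sequences supported in `{0, …, n - 1}`. -/
noncomputable def initial (hd : IsDigitSet d) : ℕ → Finset (DigitSeq d)
  | 0 => {zero hd}
  | n + 1 => (Finset.univ ×ˢ initial hd n).map (consEquiv d).toEmbedding

theorem mem_initial (hd : IsDigitSet d) (n : ℕ) (δ : DigitSeq d)
    (h : ∀ k, n ≤ k → (δ.1 k : ℝ) = 0) : δ ∈ initial hd n := by
  induction n generalizing δ with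
  | zero =>
    rw [initial, Finset.mem_singleton]
    exact Subtype.ext <| funext fun k => Subtype.ext (h k (Nat.zero_le _))
  | succ n ih =>
    rw [initial, Finset.mem_map]
    refine ⟨(consEquiv d).symm δ, ?_, (consEquiv d).apply_symm_apply δ⟩
    rw [Finset.mem_product]
    exact ⟨Finset.mem_univ _, ih _ fun k hk => h (k + 1) (by omega)⟩

theorem exists_mem_initial (hd : IsDigitSet d) (δ : DigitSeq d) :
    ∀ᶠ n in atTop, δ ∈ initial hd n := by
  obtain ⟨n, hn⟩ := eventually_atTop.1 δ.2
  exact eventually_atTop.2 ⟨n, fun m hm => mem_initial hd m δ fun k hk => hn k (hm.trans hk)⟩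

/-- The finite sets `initial hd n` eventually contain any given finite set of sequences, so for
nonnegative terms it is enough to bound the sums over them. -/
theorem summable_of_sum_initial_le (hd : IsDigitSet d) {f : DigitSeq d → ℝ} (hf : ∀ δ, 0 ≤ f δ)
    {C : ℝ} (h : ∀ n, ∑ δ ∈ initial hd n, f δ ≤ C) : Summable f := by
  refine summable_of_sum_le (c := C) hf fun u => ?_
  obtain ⟨n, hn⟩ := (u.eventually_all.2 fun δ _ => exists_mem_initial hd δ).exists
  exact (Finset.sum_le_sum_of_subset_of_nonneg (fun δ hδ => hn δ hδ) fun δ _ _ => hf δ).trans (h n)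

theorem card_mul_rpow_lt_one (hd : IsDigitSet d) (hβ : 1 < β) {σ : ℝ}
    (hσ : Real.logb β d.card < σ) : (d.card : ℝ) * β ^ (-σ) < 1 := by
  have hN : (0 : ℝ) < d.card := by
    have := hd.two_le_card
    positivity
  rw [Real.logb_lt_iff_lt_rpow hβ hN] at hσ
  rw [Real.rpow_neg (by positivity), ← div_eq_mul_inv, div_lt_one (by positivity)]
  exact hσ

theorem logb_card_pos (hd : IsDigitSet d) (hβ : 1 < β) : 0 < Real.logb β d.card :=
  Real.logb_pos hβ (by exact_mod_cast hd.two_le_card)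

/-- From (a + βλ)^{-σ} ≤ β^{-σ} λ^{-σ} for λ > 0, the sums S_n over `initial hd n` satisfy S_{n+1} ≤
q S_n + B with q = |d| β^{-σ} < 1, so they never exceed the fixed point B/(1 - q). -/
theorem summable_value_rpow (hd : IsDigitSet d) (hβ : 1 < β) {σ : ℝ}
    (hσ : Real.logb β d.card < σ) : Summable fun δ : DigitSeq d => δ.value β ^ (-σ) := by
  have hσ0 : 0 < σ := (logb_card_pos hd hβ).trans hσ
  have hq := card_mul_rpow_lt_one hd hβ hσ
  set q := (d.card : ℝ) * β ^ (-σ) with hqdef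
  set B : ℝ := ∑ a : d, (a : ℝ) ^ (-σ) with hB
  have hB0 : 0 ≤ B := Finset.sum_nonneg fun a _ => Real.rpow_nonneg (hd.nonneg _ a.2) _
  have hq0 : 0 ≤ q := by positivity
  refine summable_of_sum_initial_le hd (C := B / (1 - q))
    (fun δ => Real.rpow_nonneg (value_nonneg hd hβ δ) _) fun n => ?_
  have h1q : 0 < 1 - q := by linarith
  induction n with
  | zero =>
    -- The zero sequence contributes nothing: `0 ^ (-σ) = 0` by convention, as σ ≠ 0.
    rw [initial, Finset.sum_singleton, value_zero, Real.zero_rpow (by linarith)]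
    positivity
  | succ n ih =>
    rw [initial, Finset.sum_map, Finset.sum_product]
    classical
    -- When the higher digits all vanish the value is a itself, which the comparison with λ^{-σ}
    -- misses; the indicator term accounts for it.
    have key : ∀ a : d, ∀ δ : DigitSeq d, ((consEquiv d (a, δ)).value β) ^ (-σ) ≤
        β ^ (-σ) * δ.value β ^ (-σ) + if δ = zero hd then (a : ℝ) ^ (-σ) else 0 := by
      intro a δ
      rw [value_consEquiv]
      by_cases h : δ = zero hd
      · simp [h, value_zero, Real.zero_rpow (neg_ne_zero.2 hσ0.ne')]
      · have hv := (value_pos_iff hd hβ).2 h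
        have hβ0 : 0 < β := by linarith
        rw [if_neg h, add_zero, ← Real.mul_rpow hβ0.le hv.le]
        exact Real.rpow_le_rpow_of_nonpos (by positivity)
          (le_add_of_nonneg_left (hd.nonneg _ a.2)) (by linarith)
    calc ∑ a : d, ∑ δ ∈ initial hd n, ((consEquiv d).toEmbedding (a, δ)).value β ^ (-σ)
        ≤ ∑ a : d, (β ^ (-σ) * (B / (1 - q)) + (a : ℝ) ^ (-σ)) := by
          refine Finset.sum_le_sum fun a _ => (Finset.sum_le_sum fun δ _ => key a δ).trans ?_
          rw [Finset.sum_add_distrib, ← Finset.mul_sum, Finset.sum_ite_eq']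
          gcongr
          split_ifs
          · exact le_rfl
          · exact Real.rpow_nonneg (hd.nonneg _ a.2) _
      _ = q * (B / (1 - q)) + B := by
          rw [Finset.sum_add_distrib, Finset.sum_const, Finset.card_univ, Fintype.card_coe,
            nsmul_eq_mul, hqdef]
          ring
      _ = B / (1 - q) := by field_simp; ring

/-- `e^{-vt}` is dominated by a power of `v`. -/
theorem exp_neg_le {x : ℝ} (hx : 0 < x) (m : ℕ) : Real.exp (-x) ≤ m.factorial * x ^ (-(m : ℝ)) := by
  have := Real.pow_div_factorial_le_exp x hx.le m
  rw [Real.exp_neg, Real.rpow_neg hx.le, Real.rpow_natCast, ← div_eq_mul_inv, inv_le_comm₀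
    (Real.exp_pos _) (by positivity), inv_div]
  exact this

theorem exp_value_le (hd : IsDigitSet d) (hβ : 1 < β) (m : ℕ) {t : ℝ} (ht : 0 < t)
    {δ : DigitSeq d} (h : δ ≠ zero hd) :
    Real.exp (-δ.value β * t) ≤
      m.factorial * t ^ (-(m : ℝ)) * δ.value β ^ (-(m : ℝ)) := by
  have hv := (value_pos_iff hd hβ).2 h
  have := exp_neg_le (mul_pos ht hv) m
  rw [Real.mul_rpow ht.le hv.le, ← mul_assoc] at this
  convert this using 2
  ring

theorem summable_exp (hd : IsDigitSet d) (hβ : 1 < β) {t : ℝ} (ht : 0 < t) :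
    Summable fun δ : DigitSeq d => Real.exp (-δ.value β * t) := by
  classical
  obtain ⟨m, hm⟩ := exists_nat_gt (Real.logb β d.card)
  have h1 := (summable_value_rpow hd hβ hm).mul_left (m.factorial * t ^ (-(m : ℝ)))
  have h2 : Summable fun δ : DigitSeq d => if δ = zero hd then (1 : ℝ) else 0 :=
    summable_of_ne_finset_zero (s := {zero hd}) fun δ hδ => if_neg (by simpa using hδ)
  refine Summable.of_nonneg_of_le (fun δ => (Real.exp_pos _).le) (fun δ => ?_) (h1.add h2)
  by_cases h : δ = zero hd
  · simp only [h, value_zero, neg_zero, zero_mul, Real.exp_zero, if_true]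
    have : (0:ℝ) ≤ (0 : ℝ) ^ (-(m : ℝ)) := Real.rpow_nonneg le_rfl _
    have := mul_nonneg (show (0:ℝ) ≤ m.factorial * t ^ (-(m : ℝ)) by positivity) this
    linarith
  · rw [if_neg h, add_zero]
    exact exp_value_le hd hβ m ht h

/-- A summable family has countable support and exponentials never vanish; base 2 is an arbitrary
choice. Countability is needed to exchange sum and integral. -/
theorem countable (hd : IsDigitSet d) : Countable (DigitSeq d) := by
  have h := (summable_exp hd one_lt_two one_pos).countable_support
  have : Function.support (fun δ : DigitSeq d => Real.exp (-δ.value 2 * 1)) = Set.univ := by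
    ext δ
    simp [Real.exp_ne_zero]
  rwa [this, Set.countable_univ_iff] at h

end DigitSeq

open DigitSeq

/-! ### The exponential sum over digit sequences -/

/-- The digit sequences that represent a positive number. -/
abbrev PosSeq (β : ℝ) (d : Finset ℝ) : Type := {δ : DigitSeq d // 0 < δ.value β}

/-- `∑_{δ ∈ d} e^{-δ t}`. -/
noncomputable def digitGF (d : Finset ℝ) (t : ℝ) : ℝ := ∑ δ ∈ d, Real.exp (-δ * t)

/-- `∑ e^{-λ t}` over all digit sequences, `λ` being the number they represent. -/
noncomputable def seqGF (β : ℝ) (d : Finset ℝ) (t : ℝ) : ℝ :=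
  ∑' δ : DigitSeq d, Real.exp (-δ.value β * t)

section

variable {d : Finset ℝ} {β : ℝ}

theorem digitGF_pos (hd : IsDigitSet d) (t : ℝ) : 0 < digitGF d t :=
  Finset.sum_pos (fun _ _ => Real.exp_pos _) ⟨0, hd.zero_mem⟩

theorem seqGF_eq_mul (hd : IsDigitSet d) (hβ : 1 < β) {t : ℝ} (ht : 0 < t) :
    seqGF β d t = digitGF d t * seqGF β d (β * t) := by
  have hs : Summable fun p : d × DigitSeq d => Real.exp (-(consEquiv d p).value β * t) :=
    (consEquiv d).summable_iff.2 (summable_exp hd hβ ht)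
  rw [seqGF, ← (consEquiv d).tsum_eq, hs.tsum_prod, tsum_fintype, digitGF, Finset.sum_mul,
    ← Finset.sum_coe_sort d]
  refine Finset.sum_congr rfl fun a _ => ?_
  rw [seqGF, ← tsum_mul_left]
  refine tsum_congr fun δ => ?_
  rw [value_consEquiv, ← Real.exp_add]
  congr 1
  ring

theorem hasSum_posSeq (hd : IsDigitSet d) (hβ : 1 < β) {t : ℝ} (ht : 0 < t) :
    HasSum (fun δ : PosSeq β d => Real.exp (-δ.1.value β * t)) (seqGF β d t - 1) := by
  classical
  have h := (summable_exp hd hβ ht).hasSum.update (zero hd) 0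
  rw [value_zero, neg_zero, zero_mul, Real.exp_zero] at h
  have hset : {δ : DigitSeq d | 0 < δ.value β} = {δ | δ ≠ zero hd} := by
    ext δ
    exact value_pos_iff hd hβ
  have : HasSum (fun δ : DigitSeq d =>
      {δ : DigitSeq d | 0 < δ.value β}.indicator (fun δ => Real.exp (-δ.value β * t)) δ)
      (seqGF β d t - 1) := by
    convert! h using 1
    · funext δ
      rw [hset, Set.indicator_apply]
      by_cases hδ : δ = zero hd
      · simp [hδ]
      · simp [hδ]
    · rw [seqGF]
      ring
  exact (hasSum_subtype_iff_indicator (s := {δ : DigitSeq d | 0 < δ.value β})).2 this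

theorem one_le_seqGF (hd : IsDigitSet d) (hβ : 1 < β) {t : ℝ} (ht : 0 < t) :
    1 ≤ seqGF β d t := by
  have := (hasSum_posSeq hd hβ ht).nonneg fun δ => (Real.exp_pos _).le
  linarith

theorem summable_posSeq_rpow (hd : IsDigitSet d) (hβ : 1 < β) {σ : ℝ}
    (hσ : Real.logb β d.card < σ) : Summable fun δ : PosSeq β d => δ.1.value β ^ (-σ) :=
  (summable_value_rpow hd hβ hσ).subtype _

/-- Only the zero sequence survives: for an integer m > D the others together contribute O(t^{-m}).
-/
theorem tendsto_seqGF (hd : IsDigitSet d) (hβ : 1 < β) :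
    Tendsto (seqGF β d) atTop (𝓝 1) := by
  obtain ⟨m, hm⟩ := exists_nat_gt (Real.logb β d.card)
  have hm0 : (0 : ℝ) < m := (logb_card_pos hd hβ).trans hm
  set S := ∑' δ : PosSeq β d, δ.1.value β ^ (-(m : ℝ)) with hS
  have hlim : Tendsto (fun t : ℝ => 1 + m.factorial * t ^ (-(m : ℝ)) * S) atTop (𝓝 1) := by
    have := ((tendsto_rpow_neg_atTop hm0).const_mul (m.factorial : ℝ)).mul_const S
    simpa using this.const_add 1
  refine tendsto_of_tendsto_of_tendsto_of_le_of_le' tendsto_const_nhds hlim ?_ ?_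
  · filter_upwards [eventually_gt_atTop 0] with t ht using one_le_seqGF hd hβ ht
  · filter_upwards [eventually_gt_atTop 0] with t ht
    have := hasSum_le (fun δ : PosSeq β d =>
      exp_value_le hd hβ m ht ((value_pos_iff hd hβ).1 δ.2)) (hasSum_posSeq hd hβ ht)
      ((summable_posSeq_rpow hd hβ hm).hasSum.mul_left _)
    linarith

theorem continuousOn_seqGF (hd : IsDigitSet d) (hβ : 1 < β) :
    ContinuousOn (seqGF β d) (Set.Ioi 0) := by
  intro t ht
  have ht2 : (0 : ℝ) < t / 2 := half_pos ht
  have : ContinuousOn (seqGF β d) (Set.Ioi (t / 2)) := by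
    refine continuousOn_tsum (fun δ => by fun_prop) (summable_exp hd hβ ht2) fun δ x hx => ?_
    rw [Real.norm_of_nonneg (Real.exp_pos _).le]
    have := value_nonneg hd hβ δ
    have hx' : t / 2 ≤ x := le_of_lt hx
    exact Real.exp_le_exp.2 (by nlinarith)
  exact (this.continuousAt (Ioi_mem_nhds (half_lt_self ht))).continuousWithinAt

/-! ### From digit sequences to the numbers they represent -/

/-- Convergence forces δ_k β^k → 0, whereas every nonzero digit is bounded below by a positive
constant; a representing sequence is therefore finitely supported. -/
theorem repCount_eq_ncard (hd : IsDigitSet d) (hβ : 1 < β) (x : ℝ) :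
    repCount (fun k => β ^ k) d x = Set.ncard {δ : DigitSeq d | δ.value β = x} := by
  obtain ⟨m, hm, hmin⟩ := hd.exists_pos_le
  rw [repCount]
  symm
  refine Set.ncard_congr (fun δ _ => δ.1) (fun δ hδ => ?_) (fun a b _ _ h => Subtype.ext h) ?_
  · have := (δ.summable β).hasSum
    rwa [← value, show δ.value β = x from hδ] at this
  · intro δ hδ
    have hδ' : HasSum (fun k => (δ k : ℝ) * β ^ k) x := hδ
    refine ⟨⟨δ, ?_⟩, hδ'.tsum_eq, rfl⟩
    filter_upwards [hδ'.summable.tendsto_atTop_zero.eventually (gt_mem_nhds hm)] with k hk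
    by_contra h0
    have h1 := hmin _ (δ k).2 h0
    have := le_mul_of_one_le_right (hd.nonneg _ (δ k).2) (one_le_pow₀ (n := k) hβ.le)
    linarith

/-- Each sequence of value x contributes the same positive term e^{-x} to a convergent series.
Without finiteness, `Set.ncard` would return 0. -/
theorem finite_value_eq (hd : IsDigitSet d) (hβ : 1 < β) (x : ℝ) :
    {δ : DigitSeq d | δ.value β = x}.Finite := by
  have h := (summable_exp hd hβ one_pos).tendsto_cofinite_zero.eventually
    (gt_mem_nhds (Real.exp_pos (-x * 1)))
  rw [eventually_cofinite] at h
  refine h.subset fun δ hδ => ?_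
  rw [Set.mem_ofPred_eq, show δ.value β = x from hδ]
  exact lt_irrefl _

/-- Sums over sequences are grouped by value; the fibre over x has r(x) elements. -/
theorem hasSum_repCount (hd : IsDigitSet d) (hβ : 1 < β) {f : ℝ → ℂ} {S : ℂ}
    (h : HasSum (fun δ : PosSeq β d => f (δ.1.value β)) S) :
    HasSum (fun x : Set.Ioi (0 : ℝ) => (repCount (fun k => β ^ k) d x : ℂ) * f x) S := by
  let V : PosSeq β d → Set.Ioi (0 : ℝ) := fun δ => ⟨δ.1.value β, δ.2⟩
  rw [← (Equiv.sigmaFiberEquiv V).hasSum_iff] at h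
  refine h.sigma fun x => ?_
  let e : {δ : PosSeq β d // V δ = x} ≃ {δ : DigitSeq d | δ.value β = x} :=
    { toFun := fun δ => ⟨δ.1.1, congrArg Subtype.val δ.2⟩
      invFun := fun δ => ⟨⟨δ.1, by rw [show δ.1.value β = x from δ.2]; exact x.2⟩,
        Subtype.ext δ.2⟩
      left_inv := fun _ => rfl
      right_inv := fun _ => rfl }
  have : Finite {δ : DigitSeq d | δ.value β = x} := finite_value_eq hd hβ x
  have : Fintype {δ : DigitSeq d | δ.value β = x} := Fintype.ofFinite _
  rw [repCount_eq_ncard hd hβ]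
  have hc : ∀ δ : {δ : PosSeq β d // V δ = x},
      ((fun δ : PosSeq β d => f (δ.1.value β)) ∘ (Equiv.sigmaFiberEquiv V)) ⟨x, δ⟩ = f x := by
    rintro ⟨δ, hδ⟩
    subst hδ
    rfl
  simp only [hc]
  rw [← e.symm.hasSum_iff]
  convert! hasSum_fintype (fun _ : {δ : DigitSeq d | δ.value β = x} => f x) using 1
  rw [Finset.sum_const, nsmul_eq_mul, Finset.card_univ, Fintype.card_eq_nat_card]
  rfl

/-! ### Bounds for the logarithmic digit sum at infinity and at zero -/

theorem logDigitSum_eq (d : Finset ℝ) (y : ℝ) : logDigitSum d y = Real.log (digitGF d y) := rfl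

theorem IsDigitSet.card_pos (hd : IsDigitSet d) : (0 : ℝ) < d.card := by
  have := hd.two_le_card
  positivity

theorem logDigitSum_nonneg (hd : IsDigitSet d) (y : ℝ) : 0 ≤ logDigitSum d y := by
  refine Real.log_nonneg ?_
  have := Finset.single_le_sum (f := fun δ => Real.exp (-δ * y)) (fun δ _ => (Real.exp_pos _).le)
    hd.zero_mem
  simpa using this

theorem logDigitSum_le_log_card (hd : IsDigitSet d) {y : ℝ} (hy : 0 ≤ y) :
    logDigitSum d y ≤ Real.log d.card := by
  refine Real.log_le_log (digitGF_pos hd y) ?_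
  have := Finset.sum_le_card_nsmul d (fun δ => Real.exp (-δ * y)) 1 fun δ hδ => by
    rw [Real.exp_le_one_iff]
    nlinarith [hd.nonneg δ hδ]
  simpa using this

/-- Uses log x ≤ x - 1 and e^{-x} ≤ 1/x. The crude rate 1/y suffices, since it becomes geometric
along y = β^k t. -/
theorem exists_logDigitSum_le (hd : IsDigitSet d) :
    ∃ C : ℝ, 0 ≤ C ∧ ∀ y, 0 < y → logDigitSum d y ≤ C * y⁻¹ := by
  obtain ⟨m, hm, hmin⟩ := hd.exists_pos_le
  refine ⟨d.card * m⁻¹, by positivity, fun y hy => ?_⟩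
  have h1 : digitGF d y - 1 ≤ d.card * m⁻¹ * y⁻¹ := by
    have h0 : digitGF d y - 1 = ∑ δ ∈ d.erase 0, Real.exp (-δ * y) := by
      rw [digitGF, ← Finset.add_sum_erase d _ hd.zero_mem]
      simp
    rw [h0]
    have := Finset.sum_le_card_nsmul (d.erase 0) (fun δ => Real.exp (-δ * y)) (m⁻¹ * y⁻¹)
      fun δ hδ => by
        rw [Finset.mem_erase] at hδ
        have h2 := hmin δ hδ.2 hδ.1
        have h3 : 0 < m * y := by positivity
        have h4 := DigitSeq.exp_neg_le h3 1
        rw [Nat.factorial_one, Nat.cast_one, one_mul, Real.rpow_neg_one, mul_inv] at h4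
        refine le_trans (Real.exp_le_exp.2 ?_) h4
        nlinarith
    refine this.trans ?_
    rw [nsmul_eq_mul, mul_assoc]
    gcongr
    exact Finset.erase_subset _ _
  exact (Real.log_le_sub_one_of_pos (digitGF_pos hd y)).trans h1

/-- Every exponential in the digit sum is at least e^{-Sy}, with S the sum of all digits. -/
theorem exists_log_card_sub_le (hd : IsDigitSet d) :
    ∃ C : ℝ, 0 ≤ C ∧ ∀ y, 0 ≤ y → Real.log d.card - logDigitSum d y ≤ C * y := by
  refine ⟨∑ δ ∈ d, δ, Finset.sum_nonneg hd.nonneg, fun y hy => ?_⟩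
  have h : d.card * Real.exp (-(∑ δ ∈ d, δ) * y) ≤ digitGF d y := by
    have := Finset.card_nsmul_le_sum d (fun δ => Real.exp (-δ * y))
      (Real.exp (-(∑ δ ∈ d, δ) * y)) fun δ hδ => by
        have := Finset.single_le_sum hd.nonneg hδ
        exact Real.exp_le_exp.2 (by nlinarith)
    simpa [digitGF] using this
  have h2 := Real.log_le_log (by have := hd.card_pos; positivity) h
  rw [Real.log_mul hd.card_pos.ne' (Real.exp_ne_zero _), Real.log_exp] at h2
  rw [logDigitSum_eq]
  linarith

theorem summable_add_mul_of_le_geometric {a : ℕ → ℝ} {C q : ℝ} (hq0 : 0 ≤ q) (hq1 : q < 1)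
    (h0 : ∀ k, 0 ≤ a k) (h : ∀ k, a k ≤ C * q ^ k) (x : ℝ) :
    Summable (fun k : ℕ => ((k : ℝ) + x) * a k) := by
  have hq : ‖q‖ < 1 := by rwa [Real.norm_of_nonneg hq0]
  have h1 := ((summable_pow_mul_geometric_of_norm_lt_one 1 hq).add
    ((summable_geometric_of_norm_lt_one hq).mul_left |x|)).mul_left C
  refine Summable.of_norm_bounded h1 fun k => ?_
  rw [norm_mul, Real.norm_eq_abs, Real.norm_of_nonneg (h0 k)]
  calc |(k : ℝ) + x| * a k ≤ (k + |x|) * (C * q ^ k) := by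
        gcongr
        · exact h0 k
        · exact (abs_add_le _ _).trans (by simp)
        · exact h k
    _ = C * ((k : ℝ) ^ 1 * q ^ k + |x| * q ^ k) := by ring

theorem rpow_natCast_add (hβ : 1 < β) (k : ℕ) (w : ℝ) : β ^ ((k : ℝ) + w) = β ^ k * β ^ w := by
  rw [Real.rpow_add (by linarith), Real.rpow_natCast]

theorem rpow_neg_natCast_add (hβ : 1 < β) (k : ℕ) (w : ℝ) :
    β ^ (-(k : ℝ) + w) = (β ^ k)⁻¹ * β ^ w := by
  rw [Real.rpow_add (by linarith), Real.rpow_neg (by linarith), Real.rpow_natCast]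

theorem exists_logDigitSum_pow_le (hd : IsDigitSet d) (hβ : 1 < β) {t : ℝ} (ht : 0 < t) :
    ∃ C : ℝ, ∀ k : ℕ, logDigitSum d (β ^ k * t) ≤ C * β⁻¹ ^ k := by
  obtain ⟨C, hC, h⟩ := exists_logDigitSum_le hd
  refine ⟨C * t⁻¹, fun k => (h _ (by positivity)).trans_eq ?_⟩
  rw [mul_inv, inv_pow]
  ring

theorem summable_logDigitSum_pow (hd : IsDigitSet d) (hβ : 1 < β) {t : ℝ} (ht : 0 < t) :
    Summable fun k : ℕ => logDigitSum d (β ^ k * t) := by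
  obtain ⟨C, hC⟩ := exists_logDigitSum_pow_le hd hβ ht
  exact Summable.of_nonneg_of_le (fun k => logDigitSum_nonneg hd _) hC
    ((summable_geometric_of_lt_one (by positivity) (inv_lt_one_of_one_lt₀ hβ)).mul_left C)

theorem summable_log_card_sub (hd : IsDigitSet d) (hβ : 1 < β) {t : ℝ} (ht : 0 ≤ t) :
    Summable fun k : ℕ => Real.log d.card - logDigitSum d ((β ^ k)⁻¹ * t) := by
  obtain ⟨C, hC, h⟩ := exists_log_card_sub_le hd
  refine Summable.of_nonneg_of_le
    (fun k => sub_nonneg.2 (logDigitSum_le_log_card hd (by positivity)))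
    (fun k => h _ (by positivity)) ?_
  have := (summable_geometric_of_lt_one (by positivity)
    (inv_lt_one_of_one_lt₀ hβ)).mul_left (C * t)
  refine this.congr fun k => ?_
  rw [inv_pow]
  ring

/-! ### The product formulas -/

/-- Iterate F(t) = G(t)F(βt) and use that F tends to 1 at infinity. -/
theorem seqGF_eq_exp (hd : IsDigitSet d) (hβ : 1 < β) {t : ℝ} (ht : 0 < t) :
    seqGF β d t = Real.exp (∑' k : ℕ, logDigitSum d (β ^ k * t)) := by
  have hfin : ∀ n : ℕ, seqGF β d t =
      Real.exp (∑ k ∈ Finset.range n, logDigitSum d (β ^ k * t)) * seqGF β d (β ^ n * t) := by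
    intro n
    induction n with
    | zero => simp
    | succ n ih =>
      rw [ih, seqGF_eq_mul hd hβ (by positivity : 0 < β ^ n * t), Finset.sum_range_succ,
        Real.exp_add, logDigitSum_eq d (β ^ n * t), Real.exp_log (digitGF_pos hd _), pow_succ']
      ring_nf
  have h1 := (summable_logDigitSum_pow hd hβ ht).hasSum.tendsto_sum_nat
  have h2 : Tendsto (fun n : ℕ => β ^ n * t) atTop atTop :=
    (tendsto_pow_atTop_atTop_of_one_lt hβ).atTop_mul_const ht
  have h3 := ((Real.continuous_exp.tendsto _).comp h1).mul ((tendsto_seqGF hd hβ).comp h2)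
  rw [mul_one] at h3
  refine tendsto_nhds_unique (tendsto_const_nhds.congr hfin) h3

/-- The digit product at a positive real number. -/
noncomputable def digitProductReal (β : ℝ) (d : Finset ℝ) (t : ℝ) : ℝ :=
  Real.exp (∑' k : ℕ, (Real.log d.card - logDigitSum d ((β ^ (k + 1))⁻¹ * t)))

theorem summable_log_card_sub_succ (hd : IsDigitSet d) (hβ : 1 < β) {t : ℝ} (ht : 0 ≤ t) :
    Summable fun k : ℕ => Real.log d.card - logDigitSum d ((β ^ (k + 1))⁻¹ * t) :=
  (summable_nat_add_iff 1).2 (summable_log_card_sub hd hβ ht)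

theorem digitProduct_ofReal (hd : IsDigitSet d) (hβ : 1 < β) {t : ℝ} (ht : 0 ≤ t) :
    digitProduct β d t = digitProductReal β d t := by
  have hlog : ∀ k : ℕ, Real.log (d.card / digitGF d ((β ^ (k + 1))⁻¹ * t)) =
      Real.log d.card - logDigitSum d ((β ^ (k + 1))⁻¹ * t) := fun k => by
    rw [Real.log_div hd.card_pos.ne' (digitGF_pos hd _).ne', logDigitSum_eq]
  have h := Real.hasProd_of_hasSum_log
    (f := fun k : ℕ => d.card / digitGF d ((β ^ (k + 1))⁻¹ * t))
    (fun k => div_pos hd.card_pos (digitGF_pos hd _))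
    ((summable_log_card_sub_succ hd hβ ht).congr fun k => (hlog k).symm).hasSum
  rw [digitProductReal, ← tsum_congr hlog, digitProduct]
  refine Eq.trans ?_ (h.map Complex.ofRealHom Complex.continuous_ofReal).tprod_eq
  refine tprod_congr fun k => ?_
  rw [Function.comp_apply, Complex.ofRealHom_eq_coe]
  rw [digitGF]
  push_cast
  refine congrArg _ (Finset.sum_congr rfl fun δ _ => ?_)
  rw [mul_assoc]

theorem digitProductReal_mul (hd : IsDigitSet d) (hβ : 1 < β) {t : ℝ} (ht : 0 ≤ t) :
    digitProductReal β d t * digitGF d (β⁻¹ * t) = d.card * digitProductReal β d (β⁻¹ * t) := by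
  rw [digitProductReal, (summable_log_card_sub_succ hd hβ ht).tsum_eq_zero_add, Real.exp_add,
    Real.exp_sub, Real.exp_log hd.card_pos, logDigitSum_eq, zero_add, pow_one,
    Real.exp_log (digitGF_pos hd _), digitProductReal]
  have : ∀ k : ℕ, (β ^ (k + 1 + 1))⁻¹ * t = (β ^ (k + 1))⁻¹ * (β⁻¹ * t) := fun k => by
    rw [pow_succ β (k + 1), mul_inv]
    ring
  simp only [this]
  rw [mul_right_comm, div_mul_cancel₀ _ (digitGF_pos hd _).ne']

theorem continuousOn_digitProductReal (hd : IsDigitSet d) (hβ : 1 < β) :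
    ContinuousOn (digitProductReal β d) (Set.Ioi 0) := by
  intro t ht
  have ht0 : (0 : ℝ) < t := ht
  obtain ⟨C, hC, h⟩ := exists_log_card_sub_le hd
  have hG : Continuous (digitGF d) := by
    unfold digitGF
    fun_prop
  have hL : Continuous (logDigitSum d) := hG.log fun y => (digitGF_pos hd y).ne'
  have hs : Summable fun k : ℕ => C * ((β ^ (k + 1))⁻¹ * (2 * t)) := by
    have := (summable_geometric_of_lt_one (by positivity)
      (inv_lt_one_of_one_lt₀ hβ)).mul_left (C * β⁻¹ * (2 * t))
    refine this.congr fun k => ?_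
    rw [inv_pow, pow_succ, mul_inv]
    ring
  have : ContinuousOn (digitProductReal β d) (Set.Ioo 0 (2 * t)) := by
    refine (continuousOn_tsum (fun k => by fun_prop) hs fun k x hx => ?_).rexp
    have hx0 : 0 < x := hx.1
    rw [Real.norm_of_nonneg (sub_nonneg.2 (logDigitSum_le_log_card hd (by positivity)))]
    refine (h _ (by positivity)).trans ?_
    have := hx.2.le
    gcongr
  exact (this.continuousAt (Ioo_mem_nhds ht0 (by linarith))).continuousWithinAt

/-! ### The periodic function and the factorisation of the exponential sum -/

theorem periodicP_add_one (β : ℝ) (d : Finset ℝ) (w : ℝ) :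
    periodicP β d (w + 1) = periodicP β d w := by
  unfold periodicP
  rw [← (Equiv.addRight (1 : ℤ)).tsum_eq (fun k : ℤ => ((k : ℝ) + w + 1 / 2) *
      (logDigitSum d (β ^ ((k : ℝ) + w)) - logDigitSum d (β ^ ((k : ℝ) + 1 + w))))]
  congr 1
  refine tsum_congr fun k => ?_
  simp only [Equiv.coe_addRight, Int.cast_add, Int.cast_one]
  ring_nf

theorem HasSum.sub_shift {g : ℕ → ℝ} (hg : Summable g) : HasSum (fun k => g k - g (k + 1)) (g 0) := by
  have h := hg.hasSum.sub ((hasSum_nat_add_iff' 1).2 hg.hasSum)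
  simpa using h

/-- Abel summation on both halves of ℤ removes the linear weights and leaves the logarithms of the
two infinite products. -/
theorem periodicP_eq (hd : IsDigitSet d) (hβ : 1 < β) (w : ℝ) :
    periodicP β d w = w * Real.log d.card + (∑' k : ℕ, logDigitSum d (β ^ k * β ^ w)) -
      ∑' k : ℕ, (Real.log d.card - logDigitSum d ((β ^ (k + 1))⁻¹ * β ^ w)) := by
  have hw : 0 < β ^ w := by positivity
  set A : ℕ → ℝ := fun k => logDigitSum d (β ^ k * β ^ w) with hA
  set B : ℕ → ℝ := fun k => Real.log d.card - logDigitSum d ((β ^ k)⁻¹ * β ^ w) with hB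
  have hq : β⁻¹ < 1 := inv_lt_one_of_one_lt₀ hβ
  have hq0 : 0 ≤ β⁻¹ := by positivity
  have sA : Summable A := summable_logDigitSum_pow hd hβ hw
  have sB : Summable B := summable_log_card_sub hd hβ hw.le
  have sA' : Summable fun k : ℕ => ((k : ℝ) + (w + 1 / 2)) * A k := by
    obtain ⟨C, hC⟩ := exists_logDigitSum_pow_le hd hβ hw
    exact summable_add_mul_of_le_geometric hq0 hq (fun k => logDigitSum_nonneg hd _) hC _
  have sB' : Summable fun k : ℕ => (-(k : ℝ) + (w + 1 / 2)) * B k := by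
    obtain ⟨C, hC0, hC⟩ := exists_log_card_sub_le hd
    have := (summable_add_mul_of_le_geometric (C := C * β ^ w) hq0 hq
      (fun k => sub_nonneg.2 (logDigitSum_le_log_card hd (by positivity)))
      (fun k => (hC ((β ^ k)⁻¹ * β ^ w) (by positivity)).trans_eq (by rw [inv_pow]; ring))
      (-(w + 1 / 2))).neg
    refine this.congr fun k => ?_
    simp only [hB]
    ring
  have sA1 := (summable_nat_add_iff 1).2 sA
  -- With x = w + 1/2, (k + x)(A_k - A_{k+1}) is the telescoping difference of (k + x)A_k plus
  -- A_{k+1}. Likewise, on the negative half, it is the difference of (-k + x)B_k minus B_k.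
  have h1 := (HasSum.sub_shift sA').add sA1.hasSum
  have h2 := (HasSum.sub_shift sB').sub sB.hasSum
  set f : ℤ → ℝ := fun k => ((k : ℝ) + w + 1 / 2) *
      (logDigitSum d (β ^ ((k : ℝ) + w)) - logDigitSum d (β ^ ((k : ℝ) + 1 + w))) with hf
  have hpos : (fun k : ℕ => ((k : ℝ) + (w + 1 / 2)) * A k -
      (((k + 1 : ℕ) : ℝ) + (w + 1 / 2)) * A (k + 1) + A (k + 1)) = fun k : ℕ => f k := by
    funext k
    have e : β ^ ((k : ℝ) + 1 + w) = β ^ (k + 1) * β ^ w := by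
      rw [← rpow_natCast_add hβ]
      push_cast
      rfl
    simp only [hA, hf, Int.cast_natCast, rpow_natCast_add hβ, e]
    push_cast
    ring
  have hneg : (fun k : ℕ => (-(k : ℝ) + (w + 1 / 2)) * B k -
      (-((k + 1 : ℕ) : ℝ) + (w + 1 / 2)) * B (k + 1) - B k) = fun k : ℕ => f (-(k + 1)) := by
    funext k
    have e1 : β ^ (((-((k : ℤ) + 1) : ℤ) : ℝ) + w) = (β ^ (k + 1))⁻¹ * β ^ w := by
      rw [← rpow_neg_natCast_add hβ]
      push_cast
      rfl
    have e2 : β ^ (((-((k : ℤ) + 1) : ℤ) : ℝ) + 1 + w) = (β ^ k)⁻¹ * β ^ w := by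
      rw [← rpow_neg_natCast_add hβ]
      push_cast
      ring_nf
    simp only [hB, hf, e1, e2]
    push_cast
    ring
  rw [hpos] at h1
  rw [hneg] at h2
  have h := (HasSum.of_nat_of_neg_add_one h1 h2).tsum_eq
  rw [periodicP, h]
  -- The boundary terms give (w + 1/2)(A_0 + B_0) = (w + 1/2) log|d|. Completing one sum and
  -- dropping `B 0` from the other costs a further log|d|, so the added (1/2) log|d| makes the
  -- constant vanish.
  have hAB : B 0 = Real.log d.card - A 0 := by simp [hA, hB]
  rw [sA.tsum_eq_zero_add, sB.tsum_eq_zero_add, hAB]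
  push_cast
  ring

theorem card_rpow (hd : IsDigitSet d) (hβ : 1 < β) (w : ℝ) :
    Real.exp (w * Real.log d.card) = (β ^ w) ^ Real.logb β d.card := by
  have h0 : 0 < β := by linarith
  rw [← Real.rpow_mul h0.le, mul_comm w (Real.logb _ _), Real.rpow_mul h0.le,
    Real.rpow_logb h0 hβ.ne' hd.card_pos, Real.rpow_def_of_pos hd.card_pos, mul_comm]

theorem exp_periodicP (hd : IsDigitSet d) (hβ : 1 < β) (w : ℝ) :
    Real.exp (periodicP β d w) = (β ^ w) ^ Real.logb β d.card * seqGF β d (β ^ w) /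
      digitProductReal β d (β ^ w) := by
  have hw : 0 < β ^ w := by positivity
  rw [periodicP_eq hd hβ, Real.exp_sub, Real.exp_add, card_rpow hd hβ, seqGF_eq_exp hd hβ hw,
    digitProductReal]

/-- The central factorisation; all information about the poles comes from it. -/
theorem seqGF_eq (hd : IsDigitSet d) (hβ : 1 < β) {t : ℝ} (ht : 0 < t) :
    seqGF β d t = t ^ (-Real.logb β d.card) * Real.exp (periodicP β d (Real.logb β t)) *
      digitProductReal β d t := by
  have h0 : 0 < β := by linarith
  rw [exp_periodicP hd hβ, Real.rpow_logb h0 hβ.ne' ht, Real.rpow_neg ht.le]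
  have h1 : digitProductReal β d t ≠ 0 := Real.exp_ne_zero _
  have h2 : t ^ Real.logb β d.card ≠ 0 := by positivity
  field_simp

/-- Continuity is read off from the factorisation, whose other factors are continuous, rather than
from the bilateral series. -/
theorem continuous_exp_periodicP (hd : IsDigitSet d) (hβ : 1 < β) :
    Continuous fun w => Real.exp (periodicP β d w) := by
  have h0 : β ≠ 0 := by linarith
  have hc : Continuous fun w : ℝ => β ^ w := Real.continuous_const_rpow h0
  have hp : ∀ w : ℝ, 0 < β ^ w := fun w => by positivity
  simp only [exp_periodicP hd hβ]
  refine ((hc.rpow_const fun w => Or.inl (hp w).ne').mul ?_).div ?_ fun w => Real.exp_ne_zero _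
  · exact (continuousOn_seqGF hd hβ).comp_continuous hc hp
  · exact (continuousOn_digitProductReal hd hβ).comp_continuous hc hp

theorem periodic_exp_periodicP (β : ℝ) (d : Finset ℝ) :
    Function.Periodic (fun w => Real.exp (periodicP β d w)) 1 := fun w => by
  simp only [periodicP_add_one]

theorem exists_exp_periodicP_le (hd : IsDigitSet d) (hβ : 1 < β) :
    ∃ C : ℝ, 0 < C ∧ ∀ w, Real.exp (periodicP β d w) ≤ C := by
  obtain ⟨C, hC⟩ := isCompact_Icc.exists_bound_of_continuousOn
    (continuous_exp_periodicP hd hβ).continuousOn (s := Set.Icc (0 : ℝ) 1)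
  refine ⟨max C 1, by positivity, fun w => ?_⟩
  obtain ⟨y, hy, h⟩ := (periodic_exp_periodicP β d).exists_mem_Ico₀ one_pos w
  have := hC y ⟨hy.1, hy.2.le⟩
  rw [Real.norm_of_nonneg (Real.exp_pos _).le] at this
  exact (h.trans_le this).trans (le_max_left _ _)

/-! ### The Taylor expansion of the digit product -/

/-- `∑_{δ ∈ d} e^{-δ z}` as an entire function. -/
noncomputable def digitGFC (d : Finset ℝ) (z : ℂ) : ℂ := ∑ δ ∈ d, Complex.exp (-(δ : ℂ) * z)

theorem differentiable_digitGFC (d : Finset ℝ) : Differentiable ℂ (digitGFC d) := by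
  unfold digitGFC
  fun_prop

theorem digitGFC_ofReal (d : Finset ℝ) (t : ℝ) : digitGFC d t = digitGF d t := by
  simp [digitGFC, digitGF]

theorem digitGFC_zero (d : Finset ℝ) : digitGFC d 0 = d.card := by
  simp [digitGFC]

/-- The factor |d|/G(z) equals 1 at z = 0, so near 0 its principal logarithm is analytic and O(|z|);
along β^{-k}z this gives geometric domination. -/
theorem exists_log_factor_bound (hd : IsDigitSet d) :
    ∃ r > 0, ∃ K : ℝ, ∀ z : ℂ, ‖z‖ < r → d.card / digitGFC d z ≠ 0 ∧
      DifferentiableAt ℂ (fun z => Complex.log (d.card / digitGFC d z)) z ∧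
      ‖Complex.log (d.card / digitGFC d z)‖ ≤ K * ‖z‖ := by
  have hN : (d.card : ℂ) ≠ 0 := by exact_mod_cast hd.card_pos.ne'
  have h0 : (d.card : ℂ) / digitGFC d 0 = 1 := by rw [digitGFC_zero, div_self hN]
  have hcont : ContinuousAt (fun z => (d.card : ℂ) / digitGFC d z) 0 :=
    continuousAt_const.div (differentiable_digitGFC d).continuous.continuousAt
      (by rwa [digitGFC_zero])
  have hslit : ∀ᶠ z in 𝓝 (0 : ℂ), (d.card : ℂ) / digitGFC d z ∈ Complex.slitPlane := by
    refine hcont.eventually_mem (Complex.isOpen_slitPlane.mem_nhds ?_)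
    rw [h0]
    exact Complex.one_mem_slitPlane
  have hdiff : ∀ z : ℂ, (d.card : ℂ) / digitGFC d z ∈ Complex.slitPlane →
      DifferentiableAt ℂ (fun z => Complex.log (d.card / digitGFC d z)) z := by
    intro z hz
    have hz0 : digitGFC d z ≠ 0 := fun h => Complex.slitPlane_ne_zero hz (by rw [h, div_zero])
    exact ((differentiableAt_const _).div (differentiable_digitGFC d z) hz0).clog hz
  have hO := (hdiff 0 hslit.self_of_nhds).isBigO_sub
  obtain ⟨K, hK⟩ := hO.bound
  obtain ⟨r, hr, h⟩ := Metric.eventually_nhds_iff.1 (hslit.and hK)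
  refine ⟨r, hr, K, fun z hz => ?_⟩
  obtain ⟨h1, h2⟩ := h (y := z) (by simpa using hz)
  refine ⟨Complex.slitPlane_ne_zero h1, hdiff z h1, ?_⟩
  simpa [h0] using h2

theorem digitProduct_eq_tprod (β : ℝ) (d : Finset ℝ) (z : ℂ) :
    digitProduct β d z = ∏' k : ℕ, (d.card : ℂ) / digitGFC d (((β : ℂ) ^ (k + 1))⁻¹ * z) := by
  simp only [digitProduct, digitGFC, mul_assoc]

theorem analyticAt_digitProduct (hd : IsDigitSet d) (hβ : 1 < β) :
    AnalyticAt ℂ (digitProduct β d) 0 := by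
  obtain ⟨r, hr, K, h⟩ := exists_log_factor_bound hd
  have hn : ∀ (k : ℕ) (z : ℂ), ‖((β : ℂ) ^ (k + 1))⁻¹ * z‖ = (β ^ (k + 1))⁻¹ * ‖z‖ := fun k z => by
    rw [norm_mul, norm_inv, norm_pow, Complex.norm_real, Real.norm_of_nonneg (by linarith)]
  have hlt : ∀ (k : ℕ) (z : ℂ), ‖z‖ < r → ‖((β : ℂ) ^ (k + 1))⁻¹ * z‖ < r := fun k z hz => by
    rw [hn]
    exact (mul_le_of_le_one_left (norm_nonneg z)
      (inv_le_one_of_one_le₀ (one_le_pow₀ hβ.le))).trans_lt hz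
  have hs : Summable fun k : ℕ => |K| * ((β ^ (k + 1))⁻¹ * r) := by
    have := ((summable_nat_add_iff 1).2 (summable_geometric_of_lt_one (by positivity)
      (inv_lt_one_of_one_lt₀ hβ))).mul_left (|K| * r)
    refine this.congr fun k => ?_
    rw [inv_pow]
    ring
  have hb : ∀ (k : ℕ) (z : ℂ), z ∈ Metric.ball (0 : ℂ) r →
      ‖Complex.log (d.card / digitGFC d (((β : ℂ) ^ (k + 1))⁻¹ * z))‖ ≤
        |K| * ((β ^ (k + 1))⁻¹ * r) := fun k z hz => by
    rw [mem_ball_zero_iff] at hz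
    refine ((h _ (hlt k z hz)).2.2).trans ?_
    rw [hn]
    have := hz.le
    gcongr
    exact le_abs_self K
  have hdiff : DifferentiableOn ℂ (fun z => ∑' k : ℕ,
      Complex.log (d.card / digitGFC d (((β : ℂ) ^ (k + 1))⁻¹ * z))) (Metric.ball 0 r) := by
    refine Complex.differentiableOn_tsum_of_summable_norm hs (fun k z hz => ?_)
      Metric.isOpen_ball hb
    rw [mem_ball_zero_iff] at hz
    have h1 := (h _ (hlt k z hz)).2.1
    exact (h1.comp z (differentiableAt_id.const_mul
      ((β : ℂ) ^ (k + 1))⁻¹)).differentiableWithinAt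
  have heq : Set.EqOn (digitProduct β d) (fun z => Complex.exp (∑' k : ℕ,
      Complex.log (d.card / digitGFC d (((β : ℂ) ^ (k + 1))⁻¹ * z)))) (Metric.ball 0 r) := by
    intro z hz
    rw [digitProduct_eq_tprod]
    refine (Complex.cexp_tsum_eq_tprod (fun k => ?_) ?_).symm
    · exact (h _ (hlt k z (by simpa using hz))).1
    · exact Summable.of_norm_bounded hs fun k => hb k z hz
  exact ((hdiff.cexp).congr heq).analyticAt (Metric.ball_mem_nhds _ hr)

theorem hasFPowerSeriesAt_digitProduct (hd : IsDigitSet d) (hβ : 1 < β) :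
    HasFPowerSeriesAt (digitProduct β d)
      (FormalMultilinearSeries.ofScalars ℂ (taylorCoeff β d)) 0 :=
  (analyticAt_digitProduct hd hβ).hasFPowerSeriesAt

theorem convRadius_pos (hd : IsDigitSet d) (hβ : 1 < β) : 0 < convRadius β d :=
  (hasFPowerSeriesAt_digitProduct hd hβ).radius_pos

theorem ofScalars_apply_const (c : ℕ → ℂ) (n : ℕ) (z : ℂ) :
    (FormalMultilinearSeries.ofScalars ℂ c n fun _ => z) = c n * z ^ n := by
  rw [FormalMultilinearSeries.ofScalars_apply_eq, smul_eq_mul]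

theorem summable_norm_taylorCoeff {t : ℝ} (ht : 0 ≤ t)
    (h : ENNReal.ofReal t < convRadius β d) :
    Summable fun l : ℕ => ‖taylorCoeff β d l‖ * t ^ l := by
  have := FormalMultilinearSeries.summable_norm_mul_pow _ (r := t.toNNReal) h
  refine this.congr fun l => ?_
  rw [Real.coe_toNNReal t ht, FormalMultilinearSeries.norm_apply_eq_norm_coef,
    FormalMultilinearSeries.coeff_ofScalars]

/-- Analyticity at 0 gives equality only for small t. The functional equation H(t)G(t/β) = |d|H(t/β)
also holds for the power series on its disc, and since G > 0 on the reals it carries equality from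
t/β to t. -/
theorem hasSum_taylorCoeff (hd : IsDigitSet d) (hβ : 1 < β) {t : ℝ} (ht : 0 < t)
    (htr : ENNReal.ofReal t < convRadius β d) :
    HasSum (fun l : ℕ => taylorCoeff β d l * (t : ℂ) ^ l) (digitProductReal β d t) := by
  set p := FormalMultilinearSeries.ofScalars ℂ (taylorCoeff β d) with hp
  have hβ0 : 0 < β := by linarith
  obtain ⟨r, htr1, htr2⟩ := ENNReal.lt_iff_exists_nnreal_btwn.1 htr
  have htr : t < r := by
    rw [ENNReal.ofReal_lt_coe_iff ht.le] at htr1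
    exact htr1
  have hr0 : 0 < (r : ENNReal) := bot_le.trans_lt htr1
  have hball : HasFPowerSeriesOnBall p.sum p 0 r :=
    (p.hasFPowerSeriesOnBall (convRadius_pos hd hβ)).mono hr0 htr2.le
  set U := Metric.ball (0 : ℂ) r with hU
  have hdiff : DifferentiableOn ℂ p.sum U := by
    have := hball.differentiableOn
    rwa [Metric.eball_coe] at this
  have hinv : ∀ z : ℂ, ‖(β : ℂ)⁻¹ * z‖ ≤ ‖z‖ := fun z => by
    rw [norm_mul, norm_inv, Complex.norm_real, Real.norm_of_nonneg hβ0.le]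
    exact mul_le_of_le_one_left (norm_nonneg z) (inv_le_one_of_one_le₀ hβ.le)
  have hmaps : Set.MapsTo (fun z : ℂ => (β : ℂ)⁻¹ * z) U U := fun z hz => by
    rw [hU, mem_ball_zero_iff] at hz ⊢
    exact (hinv z).trans_lt hz
  have h1 : AnalyticOnNhd ℂ (fun z => p.sum z * digitGFC d ((β : ℂ)⁻¹ * z)) U :=
    (hdiff.mul ((differentiable_digitGFC d).comp
      (differentiable_id.const_mul _)).differentiableOn).analyticOnNhd Metric.isOpen_ball
  have h2 : AnalyticOnNhd ℂ (fun z => d.card * p.sum ((β : ℂ)⁻¹ * z)) U :=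
    ((hdiff.comp (differentiable_id.const_mul _).differentiableOn hmaps).const_mul
      (d.card : ℂ)).analyticOnNhd Metric.isOpen_ball
  have hev : ∀ᶠ z in 𝓝 (0 : ℂ), p.sum z = digitProduct β d z := by
    filter_upwards [(hasFPowerSeriesAt_digitProduct hd hβ).eventually_hasSum] with z hz
    rw [zero_add] at hz
    exact hz.tsum_eq
  obtain ⟨r₀, hr₀, hr₀'⟩ := Metric.eventually_nhds_iff.1 hev
  have hreal : ∀ x : ℝ, 0 < x → x < r₀ → p.sum (x : ℂ) = digitProductReal β d x := by
    intro x hx0 hx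
    rw [hr₀' (by simpa [abs_of_pos hx0] using hx), digitProduct_ofReal hd hβ hx0.le]
  have hfun : Set.EqOn (fun z => p.sum z * digitGFC d ((β : ℂ)⁻¹ * z))
      (fun z => d.card * p.sum ((β : ℂ)⁻¹ * z)) U := by
    refine h1.eqOn_of_preconnected_of_frequently_eq h2
      (convex_ball (0 : ℂ) r).isPreconnected
      (Metric.mem_ball_self (by simpa using hr0)) ?_
    -- Small positive reals accumulate at 0, which is enough for the identity theorem.
    have htend : Tendsto (fun x : ℝ => (x : ℂ)) (𝓝[>] 0) (𝓝[≠] 0) := by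
      refine tendsto_nhdsWithin_iff.2 ⟨?_, ?_⟩
      · exact (Complex.continuous_ofReal.tendsto' 0 0 Complex.ofReal_zero).mono_left
          nhdsWithin_le_nhds
      · filter_upwards [self_mem_nhdsWithin] with x hx
        exact Complex.ofReal_ne_zero.2 (ne_of_gt hx)
    refine htend.frequently (Eventually.frequently ?_)
    filter_upwards [Ioo_mem_nhdsGT hr₀] with x hx
    have hx' : β⁻¹ * x < r₀ :=
      (mul_le_of_le_one_left hx.1.le (inv_le_one_of_one_le₀ hβ.le)).trans_lt hx.2
    have e : (β : ℂ)⁻¹ * (x : ℂ) = ((β⁻¹ * x : ℝ) : ℂ) := by push_cast; rfl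
    rw [e, hreal x hx.1 hx.2, hreal _ (by have := hx.1; positivity) hx', digitGFC_ofReal]
    exact_mod_cast digitProductReal_mul hd hβ hx.1.le
  -- Each use of the functional equation enlarges the range of equality by the factor β, up to r.
  have key : ∀ n : ℕ, ∀ x : ℝ, 0 < x → x < r → x < r₀ * β ^ n →
      p.sum (x : ℂ) = digitProductReal β d x := by
    intro n
    induction n with
    | zero => exact fun x hx _ h => hreal x hx (by simpa using h)
    | succ n ih =>
      intro x hx hxr h
      have hle : β⁻¹ * x ≤ x := mul_le_of_le_one_left hx.le (inv_le_one_of_one_le₀ hβ.le)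
      have hi := ih (β⁻¹ * x) (by positivity) (hle.trans_lt hxr) (by
        rw [inv_mul_lt_iff₀ hβ0]
        calc x < r₀ * β ^ (n + 1) := h
          _ = β * (r₀ * β ^ n) := by ring)
      have hx2 := hfun (x := (x : ℂ)) (by simpa [hU, abs_of_pos hx] using hxr)
      have e : (β : ℂ)⁻¹ * (x : ℂ) = ((β⁻¹ * x : ℝ) : ℂ) := by push_cast; rfl
      have hr := digitProductReal_mul hd hβ hx.le
      simp only [e, hi, digitGFC_ofReal] at hx2
      have hF : (digitGF d (β⁻¹ * x) : ℂ) ≠ 0 := by exact_mod_cast (digitGF_pos hd _).ne'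
      refine mul_right_cancel₀ hF (hx2.trans ?_)
      exact_mod_cast hr.symm
  obtain ⟨n, hn⟩ := pow_unbounded_of_one_lt (t / r₀) hβ
  have hsum := hball.hasSum (y := (t : ℂ)) (by
    rw [Metric.eball_coe]
    simpa [abs_of_pos ht] using htr)
  rw [zero_add, key n t ht htr (by rwa [div_lt_iff₀' hr₀] at hn)] at hsum
  simpa only [hp, ofScalars_apply_const] using hsum

/-- `rho` is an `sInf`, which would be 0 on the empty set; nonemptiness makes it an actual member.
-/
theorem exists_lt_convRadius (hd : IsDigitSet d) (hβ : 1 < β) :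
    {h : ℕ | ENNReal.ofReal ((β ^ h)⁻¹) < convRadius β d}.Nonempty := by
  have h1 : Tendsto (fun n : ℕ => ENNReal.ofReal ((β ^ n)⁻¹)) atTop (𝓝 0) := by
    have := (tendsto_inv_atTop_zero.comp (tendsto_pow_atTop_atTop_of_one_lt hβ))
    simpa using ENNReal.tendsto_ofReal this
  exact (h1.eventually (gt_mem_nhds (convRadius_pos hd hβ))).exists

theorem lt_convRadius_of_rho_le (hd : IsDigitSet d) (hβ : 1 < β) {c : ℕ} (hc : rho β d ≤ c) :
    ENNReal.ofReal ((β ^ c)⁻¹) < convRadius β d := by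
  refine lt_of_le_of_lt ?_ (Nat.sInf_mem (exists_lt_convRadius hd hβ))
  refine ENNReal.ofReal_le_ofReal ?_
  have h0 : 0 < β ^ rho β d := by positivity
  exact inv_anti₀ h0 (pow_le_pow_right₀ hβ.le hc)

/-! ### The incomplete Gamma series -/

theorem norm_exp_mul_cpow {t : ℝ} (ht : 0 < t) (l : ℝ) (s : ℂ) :
    ‖(Real.exp (-l * t) : ℂ) * (t : ℂ) ^ (s - 1)‖ = t ^ (s.re - 1) * Real.exp (-l * t) := by
  rw [norm_mul, Complex.norm_real, Real.norm_of_nonneg (Real.exp_pos _).le,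
    Complex.norm_cpow_eq_rpow_re_of_pos ht, Complex.sub_re, Complex.one_re, mul_comm]

theorem integrableOn_rpow_mul_exp {x l : ℝ} (hx : -1 < x) (hl : 0 < l) :
    IntegrableOn (fun t : ℝ => t ^ x * Real.exp (-l * t)) (Set.Ioi 0) := by
  simpa using integrableOn_rpow_mul_exp_neg_mul_rpow hx one_pos hl

theorem continuousOn_exp_mul_cpow (l : ℝ) (s : ℂ) :
    ContinuousOn (fun t : ℝ => (Real.exp (-l * t) : ℂ) * (t : ℂ) ^ (s - 1)) (Set.Ioi 0) := by
  intro t ht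
  have ht0 : (0 : ℝ) < t := ht
  refine ContinuousAt.continuousWithinAt (ContinuousAt.mul (by fun_prop) ?_)
  exact (Complex.continuousAt_ofReal_cpow_const t (s - 1) (Or.inr ht0.ne'))

theorem integrableOn_exp_mul_cpow {s : ℂ} {l : ℝ} (hs : 0 < s.re) (hl : 0 < l) :
    IntegrableOn (fun t : ℝ => (Real.exp (-l * t) : ℂ) * (t : ℂ) ^ (s - 1)) (Set.Ioi 0) := by
  refine Integrable.mono' (integrableOn_rpow_mul_exp (x := s.re - 1) (by linarith) hl)
    ((continuousOn_exp_mul_cpow l s).aestronglyMeasurable measurableSet_Ioi) ?_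
  filter_upwards [ae_restrict_mem measurableSet_Ioi] with t ht
  rw [norm_exp_mul_cpow ht]

theorem upperGamma_scale {l ε : ℝ} (hl : 0 < l) (hε : 0 < ε) (s : ℂ) :
    1 / (l : ℂ) ^ s * upperGamma s (l * ε) =
      ∫ t in Set.Ioi ε, (Real.exp (-l * t) : ℂ) * (t : ℂ) ^ (s - 1) := by
  have hl0 : (l : ℂ) ≠ 0 := by exact_mod_cast hl.ne'
  have h := integral_comp_mul_left_Ioi
    (fun u : ℝ => (Real.exp (-u) : ℂ) * (u : ℂ) ^ (s - 1)) ε hl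
  have h2 : ∫ t in Set.Ioi ε, (Real.exp (-(l * t)) : ℂ) * ((l * t : ℝ) : ℂ) ^ (s - 1) =
      (l : ℂ) ^ (s - 1) * ∫ t in Set.Ioi ε, (Real.exp (-l * t) : ℂ) * (t : ℂ) ^ (s - 1) := by
    rw [← integral_const_mul]
    refine setIntegral_congr_fun measurableSet_Ioi fun t ht => ?_
    have ht0 : 0 ≤ t := (hε.trans ht).le
    simp only [Complex.ofReal_mul]
    rw [Complex.mul_cpow_ofReal_nonneg hl.le ht0, neg_mul]
    ring
  rw [h2] at h
  have h3 : (l : ℂ) ^ s = (l : ℂ) ^ (s - 1) * l := by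
    rw [Complex.cpow_sub _ _ hl0, Complex.cpow_one, div_mul_cancel₀ _ hl0]
  have h4 : (l : ℂ) ^ (s - 1) ≠ 0 := by
    rw [Complex.cpow_ne_zero_iff]
    exact Or.inl hl0
  rw [Complex.real_smul, Complex.ofReal_inv] at h
  rw [upperGamma, h3]
  have hI := congrArg (fun z : ℂ => (l : ℂ) * z) h
  simp only [mul_inv_cancel_left₀ hl0] at hI
  rw [← hI]
  field_simp

/-- The function is the Mellin transform of e^{-u} cut off below w, which vanishes near 0 and decays
faster than any power. -/
theorem differentiable_upperGamma {w : ℝ} (hw : 0 < w) :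
    Differentiable ℂ fun s => upperGamma s w := by
  intro s
  set f : ℝ → ℂ := (Set.Ioi w).indicator fun u => (Real.exp (-u) : ℂ) with hf
  have heq : (fun s => upperGamma s w) = mellin f := by
    funext s
    rw [upperGamma, mellin]
    have : ∀ t : ℝ, (t : ℂ) ^ (s - 1) • f t =
        (Set.Ioi w).indicator (fun u : ℝ => (Real.exp (-u) : ℂ) * (u : ℂ) ^ (s - 1)) t := by
      intro t
      rw [hf, Set.indicator_apply, Set.indicator_apply]
      split_ifs
      · rw [smul_eq_mul, mul_comm]
      · simp
    simp only [this]
    rw [setIntegral_indicator measurableSet_Ioi, Set.inter_eq_right.2 (Set.Ioi_subset_Ioi hw.le)]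
  rw [heq]
  refine mellin_differentiableAt_of_isBigO_rpow (a := s.re + 1) (b := s.re - 1) ?_ ?_
    (by linarith) ?_ (by linarith)
  · have h : IntegrableOn (fun u : ℝ => (Real.exp (-u) : ℂ)) (Set.Ioi w) :=
      (integrableOn_exp_neg_Ioi w).ofReal
    exact (h.integrable_indicator measurableSet_Ioi).locallyIntegrable.locallyIntegrableOn _
  · have h := (isLittleO_exp_neg_mul_rpow_atTop one_pos (-(s.re + 1))).isBigO
    refine (Asymptotics.IsBigO.of_norm_le fun t => ?_).trans h
    rw [hf, Set.indicator_apply]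
    split_ifs
    · rw [Complex.norm_real, neg_one_mul, Real.norm_of_nonneg (Real.exp_pos _).le]
    · rw [norm_zero]
      exact (Real.exp_pos _).le
  · have : f =ᶠ[𝓝[>] 0] fun _ => 0 := by
      filter_upwards [Ioo_mem_nhdsGT hw] with t ht
      rw [hf, Set.indicator_of_notMem]
      exact fun h => lt_asymm ht.2 h
    exact this.trans_isBigO (Asymptotics.isBigO_zero _ _)

/-- A locally uniform bound for the terms of the incomplete Gamma series. -/
theorem exists_upperGamma_bound {m ε : ℝ} (hm : 0 < m) (hε : 0 < ε) (hε1 : ε ≤ 1) (s₀ : ℂ) :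
    ∃ M : ℝ, ∀ s ∈ Metric.ball s₀ 1, ∀ l : ℝ, m ≤ l →
      ‖1 / (l : ℂ) ^ s * upperGamma s (l * ε)‖ ≤ M * Real.exp (-l * ε) := by
  set X := |s₀.re| with hX
  set g : ℝ → ℝ := fun t => t ^ X * Real.exp (-m * t) with hg
  have hgi : IntegrableOn g (Set.Ioi ε) :=
    (integrableOn_rpow_mul_exp (by linarith [abs_nonneg s₀.re]) hm).mono_set
      (Set.Ioi_subset_Ioi hε.le)
  refine ⟨ε ^ (s₀.re - 2) * ε ^ (-X) * Real.exp (m * ε) * ∫ t in Set.Ioi ε, g t,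
    fun s hs l hl => ?_⟩
  have hs' : |s.re - s₀.re| < 1 := by
    have h1 := Complex.abs_re_le_norm (s - s₀)
    rw [Metric.mem_ball, dist_eq_norm] at hs
    rw [Complex.sub_re] at h1
    linarith
  rw [abs_lt] at hs'
  rw [upperGamma_scale (hm.trans_le hl) hε, show ε ^ (s₀.re - 2) * ε ^ (-X) * Real.exp (m * ε) *
    (∫ t in Set.Ioi ε, g t) * Real.exp (-l * ε) = ∫ t in Set.Ioi ε, ε ^ (s₀.re - 2) * ε ^ (-X) *
      Real.exp (m * ε) * Real.exp (-l * ε) * g t by rw [integral_const_mul]; ring]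
  refine norm_integral_le_of_norm_le (hgi.const_mul _) ?_
  filter_upwards [ae_restrict_mem measurableSet_Ioi] with t ht
  have htε : ε < t := ht
  have ht0 : 0 < t := hε.trans ht
  rw [norm_exp_mul_cpow ht0]
  -- Writing t = ε(t/ε) with ε ≤ 1 ≤ t/ε lets each factor be bounded monotonically in its exponent.
  have h1 : t ^ (s.re - 1) ≤ ε ^ (s₀.re - 2) * ε ^ (-X) * t ^ X := by
    have e1 : t ^ (s.re - 1) = ε ^ (s.re - 1) * (t / ε) ^ (s.re - 1) := by
      rw [← Real.mul_rpow hε.le (by positivity), mul_div_cancel₀ _ hε.ne']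
    have e2 : ε ^ (-X) * t ^ X = (t / ε) ^ X := by
      rw [Real.div_rpow ht0.le hε.le, Real.rpow_neg hε.le]
      ring
    rw [e1, mul_assoc, e2]
    have hge : 1 ≤ t / ε := by
      rw [one_le_div hε]
      exact htε.le
    exact mul_le_mul (Real.rpow_le_rpow_of_exponent_ge hε hε1 (by linarith))
      (Real.rpow_le_rpow_of_exponent_le hge (by linarith [le_abs_self s₀.re]))
      (by positivity) (by positivity)
  -- Equivalent to (l - m)(t - ε) ≥ 0.
  have h2 : Real.exp (-l * t) ≤ Real.exp (m * ε) * Real.exp (-l * ε) * Real.exp (-m * t) := by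
    rw [← Real.exp_add, ← Real.exp_add]
    refine Real.exp_le_exp.2 ?_
    nlinarith
  calc t ^ (s.re - 1) * Real.exp (-l * t)
      ≤ (ε ^ (s₀.re - 2) * ε ^ (-X) * t ^ X) *
        (Real.exp (m * ε) * Real.exp (-l * ε) * Real.exp (-m * t)) :=
        mul_le_mul h1 h2 (Real.exp_pos _).le (by positivity)
    _ = _ := by
        simp only [hg]
        ring

/-- `∑ λ^{-s} Γ(s, λ ε)` over the digit sequences representing a positive number `λ`. -/
noncomputable def upperGammaSum (β : ℝ) (d : Finset ℝ) (ε : ℝ) (s : ℂ) : ℂ :=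
  ∑' δ : PosSeq β d, 1 / ((δ.1.value β : ℝ) : ℂ) ^ s * upperGamma s (δ.1.value β * ε)

theorem exists_upperGammaSum_bound (hd : IsDigitSet d) (hβ : 1 < β) {ε : ℝ} (hε : 0 < ε)
    (hε1 : ε ≤ 1) (s₀ : ℂ) : ∃ u : PosSeq β d → ℝ, Summable u ∧
      ∀ (δ : PosSeq β d), ∀ s ∈ Metric.ball s₀ 1,
        ‖1 / ((δ.1.value β : ℝ) : ℂ) ^ s * upperGamma s (δ.1.value β * ε)‖ ≤ u δ := by
  obtain ⟨m, hm, hmin⟩ := DigitSeq.exists_pos_le_value hd hβ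
  obtain ⟨M, hM⟩ := exists_upperGamma_bound hm hε hε1 s₀
  exact ⟨fun δ => M * Real.exp (-δ.1.value β * ε), (hasSum_posSeq hd hβ hε).summable.mul_left M,
    fun δ s hs => hM s hs _ (hmin _ δ.2)⟩

theorem hasSum_upperGammaSum (hd : IsDigitSet d) (hβ : 1 < β) {ε : ℝ} (hε : 0 < ε)
    (hε1 : ε ≤ 1) (s : ℂ) : HasSum (fun δ : PosSeq β d =>
      1 / ((δ.1.value β : ℝ) : ℂ) ^ s * upperGamma s (δ.1.value β * ε))
      (upperGammaSum β d ε s) := by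
  obtain ⟨u, hu, h⟩ := exists_upperGammaSum_bound hd hβ hε hε1 s
  exact (Summable.of_norm_bounded hu fun δ => h δ s (Metric.mem_ball_self one_pos)).hasSum

theorem differentiable_upperGammaSum (hd : IsDigitSet d) (hβ : 1 < β) {ε : ℝ} (hε : 0 < ε)
    (hε1 : ε ≤ 1) : Differentiable ℂ (upperGammaSum β d ε) := by
  intro s₀
  obtain ⟨u, hu, h⟩ := exists_upperGammaSum_bound hd hβ hε hε1 s₀
  refine (Complex.differentiableOn_tsum_of_summable_norm hu (fun δ => ?_) Metric.isOpen_ball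
    h).differentiableAt (Metric.ball_mem_nhds s₀ one_pos)
  have hv : ((δ.1.value β : ℝ) : ℂ) ≠ 0 := by exact_mod_cast δ.2.ne'
  refine (Differentiable.mul (Differentiable.div (differentiable_const _)
    (differentiable_id.const_cpow (Or.inl hv)) fun s => ?_)
    (differentiable_upperGamma (mul_pos δ.2 hε))).differentiableOn
  rw [Complex.cpow_ne_zero_iff]
  exact Or.inl hv

/-! ### The Mellin representation of the zeta function -/

/-- The zeta function as a sum over digit sequences. -/
noncomputable def zetaSum (β : ℝ) (d : Finset ℝ) (s : ℂ) : ℂ :=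
  ∑' δ : PosSeq β d, 1 / ((δ.1.value β : ℝ) : ℂ) ^ s

theorem hasSum_zetaSum (hd : IsDigitSet d) (hβ : 1 < β) {s : ℂ}
    (hs : Real.logb β d.card < s.re) :
    HasSum (fun δ : PosSeq β d => 1 / ((δ.1.value β : ℝ) : ℂ) ^ s) (zetaSum β d s) := by
  refine Summable.hasSum (Summable.of_norm_bounded (summable_posSeq_rpow hd hβ hs) fun δ => ?_)
  rw [norm_div, norm_one, Complex.norm_cpow_eq_rpow_re_of_pos δ.2, Real.rpow_neg δ.2.le, one_div]

/-- The exchange is justified because the integrals of the norms are at most Γ(Re s) λ^{-Re s},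
summable for Re s > D. -/
theorem hasSum_integral_seqGF (hd : IsDigitSet d) (hβ : 1 < β) (ε : ℝ) {s : ℂ}
    (hs : Real.logb β d.card < s.re) :
    HasSum (fun δ : PosSeq β d => ∫ t in Set.Ioc 0 ε,
        (Real.exp (-δ.1.value β * t) : ℂ) * (t : ℂ) ^ (s - 1))
      (∫ t in Set.Ioc 0 ε, ((seqGF β d t - 1 : ℝ) : ℂ) * (t : ℂ) ^ (s - 1)) := by
  have hs0 : 0 < s.re := (DigitSeq.logb_card_pos hd hβ).trans hs
  have := DigitSeq.countable hd
  have hsub : Set.Ioc 0 ε ⊆ Set.Ioi (0 : ℝ) := fun t ht => ht.1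
  have h := hasSum_integral_of_summable_integral_norm (μ := volume.restrict (Set.Ioc 0 ε))
    (F := fun (δ : PosSeq β d) (t : ℝ) =>
      (Real.exp (-δ.1.value β * t) : ℂ) * (t : ℂ) ^ (s - 1))
    (fun δ => (integrableOn_exp_mul_cpow hs0 δ.2).mono_set hsub) ?_
  · convert! h using 1
    refine setIntegral_congr_fun measurableSet_Ioc fun t ht => ?_
    rw [tsum_mul_right, ← Complex.ofReal_tsum, (hasSum_posSeq hd hβ ht.1).tsum_eq]
  · refine Summable.of_nonneg_of_le (fun δ => integral_nonneg fun t => norm_nonneg _) (fun δ => ?_)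
      ((summable_posSeq_rpow hd hβ hs).mul_right (Real.Gamma s.re))
    have h1 : ∫ t in Set.Ioc 0 ε, ‖(Real.exp (-δ.1.value β * t) : ℂ) * (t : ℂ) ^ (s - 1)‖ ≤
        ∫ t in Set.Ioi 0, ‖(Real.exp (-δ.1.value β * t) : ℂ) * (t : ℂ) ^ (s - 1)‖ :=
      setIntegral_mono_set (integrableOn_exp_mul_cpow hs0 δ.2).norm
        (Eventually.of_forall fun t => norm_nonneg _) hsub.eventuallyLE
    refine h1.trans_eq ?_
    have h2 := Real.integral_rpow_mul_exp_neg_mul_Ioi hs0 δ.2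
    rw [Real.rpow_neg δ.2.le, ← Real.inv_rpow δ.2.le, ← one_div, ← h2]
    refine setIntegral_congr_fun measurableSet_Ioi fun t ht => ?_
    rw [norm_exp_mul_cpow ht, neg_mul]

theorem Gamma_mul_zetaSum (hd : IsDigitSet d) (hβ : 1 < β) {ε : ℝ} (hε : 0 < ε) (hε1 : ε ≤ 1)
    {s : ℂ} (hs : Real.logb β d.card < s.re) :
    Complex.Gamma s * zetaSum β d s = upperGammaSum β d ε s +
      ∫ t in Set.Ioc 0 ε, ((seqGF β d t - 1 : ℝ) : ℂ) * (t : ℂ) ^ (s - 1) := by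
  have hs0 : 0 < s.re := (DigitSeq.logb_card_pos hd hβ).trans hs
  refine ((hasSum_zetaSum hd hβ hs).mul_left (Complex.Gamma s)).unique ?_
  convert! (hasSum_upperGammaSum hd hβ hε hε1 s).add (hasSum_integral_seqGF hd hβ ε hs) using 1
  funext δ
  have hi := integrableOn_exp_mul_cpow hs0 δ.2
  have h := Complex.integral_cpow_mul_exp_neg_mul_Ioi (r := δ.1.value β) hs0 δ.2
  rw [upperGamma_scale δ.2 hε, add_comm, ← setIntegral_union
    (Set.Ioc_disjoint_Ioi le_rfl) measurableSet_Ioi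
    (hi.mono_set fun t ht => ht.1) (hi.mono_set (Set.Ioi_subset_Ioi hε.le)),
    Set.Ioc_union_Ioi_eq_Ioi hε.le]
  have e : (1 / (δ.1.value β : ℂ)) ^ s = 1 / (δ.1.value β : ℂ) ^ s := by
    rw [one_div, one_div, Complex.inv_cpow]
    rw [Complex.arg_ofReal_of_nonneg δ.2.le]
    exact Real.pi_ne_zero.symm
  rw [mul_comm, ← e, ← h]
  refine setIntegral_congr_fun measurableSet_Ioi fun t ht => ?_
  push_cast
  rw [mul_comm, neg_mul]

/-! ### Mellin integrals of log-periodic functions -/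

/-- `∫_0^1 e^{P(u)} β^{z u} du`. -/
noncomputable def periodIntegral (β : ℝ) (d : Finset ℝ) (z : ℂ) : ℂ :=
  ∫ u in (0 : ℝ)..1, (Real.exp (periodicP β d u) : ℂ) * (β : ℂ) ^ (z * u)

/-- `∫_0^{β^{-c}} e^{P(log_β t)} t^{z - 1} dt`, in closed form. -/
noncomputable def mellinKernel (β : ℝ) (d : Finset ℝ) (c : ℕ) (z : ℂ) : ℂ :=
  (β : ℂ) ^ (-z * c) * (Real.log β : ℂ) / ((β : ℂ) ^ z - 1) * periodIntegral β d z

theorem mellinTerm_eq (β : ℝ) (d : Finset ℝ) (c : ℕ) (s : ℂ) (l : ℕ) :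
    mellinTerm β d c s l =
      taylorCoeff β d l * mellinKernel β d c (s + l - (Real.logb β d.card : ℂ)) := by
  rw [mellinTerm, mellinKernel, periodIntegral]
  ring

theorem ofReal_rpow_cpow (hβ : 1 < β) (x : ℝ) (z : ℂ) :
    ((β ^ x : ℝ) : ℂ) ^ z = (β : ℂ) ^ (x * z) := by
  have hβ0 : 0 ≤ β := by linarith
  have him : (Complex.log β * x).im = 0 := by
    rw [← Complex.ofReal_log hβ0, ← Complex.ofReal_mul, Complex.ofReal_im]
  rw [Complex.ofReal_cpow hβ0, Complex.cpow_mul _ (by rw [him]; linarith [Real.pi_pos])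
    (by rw [him]; exact Real.pi_pos.le)]

/-- The integrand `e^{P(log_β t)} t^{z - 1}`. -/
noncomputable def logPeriodicPow (β : ℝ) (d : Finset ℝ) (z : ℂ) (t : ℝ) : ℂ :=
  (Real.exp (periodicP β d (Real.logb β t)) : ℂ) * (t : ℂ) ^ (z - 1)

theorem continuousOn_logPeriodicPow (hd : IsDigitSet d) (hβ : 1 < β) (z : ℂ) :
    ContinuousOn (logPeriodicPow β d z) (Set.Ioi 0) := by
  refine ContinuousOn.mul ?_ fun t ht =>
    (Complex.continuousAt_ofReal_cpow_const t (z - 1) (Or.inr (ne_of_gt ht))).continuousWithinAt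
  have h : ContinuousOn (Real.logb β) (Set.Ioi 0) := fun t ht =>
    (Real.continuousAt_logb (ne_of_gt ht)).continuousWithinAt
  exact Complex.continuous_ofReal.comp_continuousOn
    ((continuous_exp_periodicP hd hβ).comp_continuousOn h)

theorem norm_logPeriodicPow_le {C : ℝ} (hC : ∀ w, Real.exp (periodicP β d w) ≤ C) (z : ℂ) {t : ℝ}
    (ht : 0 < t) : ‖logPeriodicPow β d z t‖ ≤ C * t ^ (z.re - 1) := by
  rw [logPeriodicPow, norm_mul, Complex.norm_real, Real.norm_of_nonneg (Real.exp_pos _).le,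
    Complex.norm_cpow_eq_rpow_re_of_pos ht, Complex.sub_re, Complex.one_re]
  gcongr
  exact hC _

theorem integrableOn_rpow_Ioc {x : ℝ} (hx : 0 < x) (a : ℝ) :
    IntegrableOn (fun t : ℝ => t ^ (x - 1)) (Set.Ioc 0 a) :=
  (intervalIntegral.intervalIntegrable_rpow' (a := 0) (b := a) (by linarith)).1

theorem integrableOn_logPeriodicPow (hd : IsDigitSet d) (hβ : 1 < β) {z : ℂ} (hz : 0 < z.re)
    (a : ℝ) : IntegrableOn (logPeriodicPow β d z) (Set.Ioc 0 a) := by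
  obtain ⟨C, _, hC⟩ := exists_exp_periodicP_le hd hβ
  refine Integrable.mono' ((integrableOn_rpow_Ioc hz a).const_mul C)
    (((continuousOn_logPeriodicPow hd hβ z).mono fun t ht => ht.1).aestronglyMeasurable
      measurableSet_Ioc) ?_
  filter_upwards [ae_restrict_mem measurableSet_Ioc] with t ht
  exact norm_logPeriodicPow_le hC z ht.1

theorem one_lt_norm_cpow (hβ : 1 < β) {z : ℂ} (hz : 0 < z.re) : 1 < ‖(β : ℂ) ^ z‖ := by
  rw [Complex.norm_cpow_eq_rpow_re_of_pos (by linarith)]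
  exact Real.one_lt_rpow hβ hz

theorem cpow_ne_one (hβ : 1 < β) {z : ℂ} (hz : 0 < z.re) : (β : ℂ) ^ z ≠ 1 := fun h => by
  have := one_lt_norm_cpow hβ hz
  rw [h, norm_one] at this
  exact lt_irrefl _ this

theorem integral_logPeriodicPow_scaled (hβ : 1 < β) (z : ℂ) {ε : ℝ} (hε : 0 ≤ ε) :
    (∫ t in (0 : ℝ)..(β⁻¹ * ε), logPeriodicPow β d z t) =
      (β : ℂ) ^ (-z) * ∫ t in (0 : ℝ)..ε, logPeriodicPow β d z t := by
  have hβ0 : 0 < β := by linarith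
  have hβC : (β : ℂ) ≠ 0 := by exact_mod_cast hβ0.ne'
  have h := intervalIntegral.integral_comp_mul_left (a := 0) (b := ε) (logPeriodicPow β d z)
    (inv_ne_zero hβ0.ne')
  have h2 : (∫ t in (0 : ℝ)..ε, logPeriodicPow β d z (β⁻¹ * t)) =
      ∫ t in (0 : ℝ)..ε, (β : ℂ) ^ (1 - z) * logPeriodicPow β d z t := by
    refine intervalIntegral.integral_congr_uIoo fun t ht => ?_
    rw [Set.uIoo_of_le hε] at ht
    have ht0 : 0 < t := ht.1
    have e : Real.logb β (β⁻¹ * t) = Real.logb β t - 1 := by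
      rw [Real.logb_mul (inv_ne_zero hβ0.ne') ht0.ne', Real.logb_inv, Real.logb_self_eq_one hβ]
      ring
    have e2 : Real.exp (periodicP β d (Real.logb β t - 1)) =
        Real.exp (periodicP β d (Real.logb β t)) := (periodic_exp_periodicP β d).sub_eq _
    rw [logPeriodicPow, e, e2, logPeriodicPow, Complex.ofReal_mul,
      Complex.mul_cpow_ofReal_nonneg (inv_pos.2 hβ0).le ht0.le, Complex.ofReal_inv,
      Complex.inv_cpow _ _ (by
        rw [Complex.arg_ofReal_of_nonneg hβ0.le]; exact Real.pi_ne_zero.symm),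
      ← Complex.cpow_neg, neg_sub]
    ring
  rw [h2, intervalIntegral.integral_const_mul, mul_zero, inv_inv, Complex.real_smul,
    Complex.cpow_sub _ _ hβC, Complex.cpow_one] at h
  rw [Complex.cpow_neg]
  refine mul_left_cancel₀ hβC (h.symm.trans ?_)
  ring

/-- Substitute t = β^{u-c-1} for u in [0, 1]; periodicity removes the integer shift inside P. -/
theorem integral_logPeriodicPow_period (hd : IsDigitSet d) (hβ : 1 < β) (z : ℂ) (c : ℕ) :
    (∫ t in (β⁻¹ * (β ^ c)⁻¹)..(β ^ c)⁻¹, logPeriodicPow β d z t) =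
      Real.log β * (β : ℂ) ^ (-z * c) * (β : ℂ) ^ (-z) * periodIntegral β d z := by
  have hβ0 : 0 < β := by linarith
  have hβC : (β : ℂ) ≠ 0 := by exact_mod_cast hβ0.ne'
  set φ : ℝ → ℝ := fun u => β ^ (u - (c + 1 : ℕ)) with hφ
  have hφ0 : φ 0 = β⁻¹ * (β ^ c)⁻¹ := by
    simp only [hφ]
    rw [zero_sub, Real.rpow_neg hβ0.le, Real.rpow_natCast, pow_succ', mul_inv]
  have hφ1 : φ 1 = (β ^ c)⁻¹ := by
    simp only [hφ]
    rw [show (1 : ℝ) - (c + 1 : ℕ) = -(c : ℝ) by push_cast; ring, Real.rpow_neg hβ0.le,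
      Real.rpow_natCast]
  have hder : ∀ u : ℝ, HasDerivAt φ (φ u * Real.log β) u := fun u => by
    have := ((hasDerivAt_id u).sub_const ((c + 1 : ℕ) : ℝ)).const_rpow hβ0
    convert! this using 1
    simp only [hφ, id]
    ring
  have hpos : ∀ u, 0 < φ u := fun u => Real.rpow_pos_of_pos hβ0 _
  have hcont : Continuous φ := continuous_iff_continuousAt.2 fun u => (hder u).continuousAt
  have h := intervalIntegral.integral_deriv_smul_comp' (a := 0) (b := 1) (f := φ)
    (f' := fun u => φ u * Real.log β) (g := logPeriodicPow β d z)
    (fun u _ => hder u) (by fun_prop)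
    ((continuousOn_logPeriodicPow hd hβ z).mono (by
      rintro _ ⟨u, _, rfl⟩
      exact hpos u))
  rw [hφ0, hφ1] at h
  rw [← h, periodIntegral, ← intervalIntegral.integral_const_mul]
  refine intervalIntegral.integral_congr fun u _ => ?_
  have e1 : Real.logb β (φ u) = u - (c + 1 : ℕ) := Real.logb_rpow hβ0 hβ.ne'
  have e2 : Real.exp (periodicP β d (u - (c + 1 : ℕ))) = Real.exp (periodicP β d u) := by
    simpa using (periodic_exp_periodicP β d).sub_nat_mul_eq (c + 1) (x := u)
  have e3 : (φ u : ℂ) * (φ u : ℂ) ^ (z - 1) =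
      (β : ℂ) ^ (-z * c) * (β : ℂ) ^ (-z) * (β : ℂ) ^ (z * u) := by
    have hφC : (φ u : ℂ) ≠ 0 := by exact_mod_cast (hpos u).ne'
    rw [Complex.cpow_sub _ _ hφC, Complex.cpow_one, mul_div_cancel₀ _ hφC,
      ← Complex.cpow_add _ _ hβC, ← Complex.cpow_add _ _ hβC]
    simp only [hφ]
    rw [ofReal_rpow_cpow hβ]
    congr 1
    push_cast
    ring
  simp only [Function.comp_apply, logPeriodicPow]
  rw [e1, e2, Complex.real_smul, Complex.ofReal_mul]
  linear_combination (Real.log β : ℂ) * (Real.exp (periodicP β d u) : ℂ) * e3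

/-- The integral J up to β^{-c} satisfies J = β^{-z}J + (one period); solving for J gives the closed
form. -/
theorem integral_logPeriodicPow (hd : IsDigitSet d) (hβ : 1 < β) {z : ℂ} (hz : 0 < z.re) (c : ℕ) :
    (∫ t in Set.Ioc 0 (β ^ c)⁻¹, logPeriodicPow β d z t) = mellinKernel β d c z := by
  have hβ0 : 0 < β := by linarith
  have hβC : (β : ℂ) ≠ 0 := by exact_mod_cast hβ0.ne'
  have hε : (0 : ℝ) ≤ (β ^ c)⁻¹ := by positivity
  rw [← intervalIntegral.integral_of_le hε]
  have hii : ∀ a : ℝ, 0 ≤ a → IntervalIntegrable (logPeriodicPow β d z) volume 0 a := fun a ha =>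
    (intervalIntegrable_iff_integrableOn_Ioc_of_le ha).2 (integrableOn_logPeriodicPow hd hβ hz a)
  have h1 := intervalIntegral.integral_add_adjacent_intervals (hii (β⁻¹ * (β ^ c)⁻¹)
    (by positivity)) ((hii (β⁻¹ * (β ^ c)⁻¹) (by positivity)).symm.trans (hii _ hε))
  rw [integral_logPeriodicPow_scaled hβ z hε, integral_logPeriodicPow_period hd hβ z c] at h1
  have hne : (β : ℂ) ^ z - 1 ≠ 0 := sub_ne_zero.2 (cpow_ne_one hβ hz)
  have hz0 : (β : ℂ) ^ z ≠ 0 := by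
    rw [Complex.cpow_ne_zero_iff]
    exact Or.inl hβC
  rw [mellinKernel, div_mul_eq_mul_div, eq_div_iff hne]
  rw [Complex.cpow_neg] at h1
  generalize (∫ t in (0 : ℝ)..(β ^ c)⁻¹, logPeriodicPow β d z t) = J at h1 ⊢
  generalize (β : ℂ) ^ (-z * c) = B at h1 ⊢
  field_simp at h1
  linear_combination -h1

theorem seqGF_mul_cpow (hd : IsDigitSet d) (hβ : 1 < β) (s : ℂ) {t : ℝ} (ht : 0 < t) :
    (seqGF β d t : ℂ) * (t : ℂ) ^ (s - 1) =
      digitProductReal β d t * logPeriodicPow β d (s - (Real.logb β d.card : ℂ)) t := by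
  have htC : (t : ℂ) ≠ 0 := by exact_mod_cast ht.ne'
  rw [seqGF_eq hd hβ ht, logPeriodicPow,
    show s - (Real.logb β d.card : ℂ) - 1 = -(Real.logb β d.card : ℂ) + (s - 1) by ring,
    Complex.cpow_add _ _ htC, ← Complex.ofReal_neg, ← Complex.ofReal_cpow ht.le]
  push_cast
  ring

/-- Termwise integration is allowed because t^ℓ ≤ ε^ℓ on the interval and ∑|c(ℓ)|ε^ℓ converges, ε =
β^{-c} being smaller than σ. -/
theorem hasSum_mellinTerm (hd : IsDigitSet d) (hβ : 1 < β) {c : ℕ} (hc : rho β d ≤ c) {s : ℂ}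
    (hs : Real.logb β d.card < s.re) :
    HasSum (fun l : ℕ => mellinTerm β d c s l)
      (∫ t in Set.Ioc 0 (β ^ c)⁻¹, (seqGF β d t : ℂ) * (t : ℂ) ^ (s - 1)) := by
  have hβ0 : 0 < β := by linarith
  set D := Real.logb β d.card with hD
  set ε := (β ^ c)⁻¹ with hε
  have hε0 : 0 < ε := by positivity
  obtain ⟨C, hC0, hC⟩ := exists_exp_periodicP_le hd hβ
  have hre : ∀ l : ℕ, (s + l - (D : ℂ)).re = s.re - D + l := fun l => by
    simp
    ring
  have hzpos : ∀ l : ℕ, 0 < (s + l - (D : ℂ)).re := fun l => by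
    rw [hre]
    have : (0 : ℝ) ≤ l := l.cast_nonneg
    linarith
  have hx : 0 < s.re - D := by linarith
  have h := hasSum_integral_of_summable_integral_norm (μ := volume.restrict (Set.Ioc 0 ε))
    (F := fun (l : ℕ) (t : ℝ) =>
      taylorCoeff β d l * logPeriodicPow β d (s + l - (D : ℂ)) t)
    (fun l => (integrableOn_logPeriodicPow hd hβ (hzpos l) ε).const_mul _) ?_
  · convert! h using 1
    · funext l
      rw [integral_const_mul, integral_logPeriodicPow hd hβ (hzpos l), mellinTerm_eq]
    · refine setIntegral_congr_fun measurableSet_Ioc fun t ht => ?_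
      have ht0 : 0 < t := ht.1
      have htC : (t : ℂ) ≠ 0 := by exact_mod_cast ht0.ne'
      have hlt : ENNReal.ofReal t < convRadius β d :=
        (ENNReal.ofReal_le_ofReal ht.2).trans_lt (lt_convRadius_of_rho_le hd hβ hc)
      have h2 := (hasSum_taylorCoeff hd hβ ht0 hlt).mul_right (logPeriodicPow β d (s - (D : ℂ)) t)
      have h3 : (fun l : ℕ => taylorCoeff β d l * logPeriodicPow β d (s + l - (D : ℂ)) t) =
          fun l : ℕ => taylorCoeff β d l * (t : ℂ) ^ l * logPeriodicPow β d (s - (D : ℂ)) t := by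
        funext l
        rw [logPeriodicPow, logPeriodicPow,
          show s + l - (D : ℂ) - 1 = (l : ℂ) + (s - D - 1) by ring,
          Complex.cpow_add _ _ htC, Complex.cpow_natCast]
        ring
      rw [h3, h2.tsum_eq, seqGF_mul_cpow hd hβ s ht0]
  · refine Summable.of_nonneg_of_le (fun l => integral_nonneg fun t => norm_nonneg _) (fun l => ?_)
      ((summable_norm_taylorCoeff hε0.le (lt_convRadius_of_rho_le hd hβ hc)).mul_right
        (∫ t in Set.Ioc 0 ε, C * t ^ (s.re - D - 1)))
    rw [← integral_const_mul]
    refine setIntegral_mono_on ((integrableOn_logPeriodicPow hd hβ (hzpos l) ε).const_mul _).norm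
      (((integrableOn_rpow_Ioc hx ε).const_mul C).const_mul _) measurableSet_Ioc fun t ht => ?_
    have ht0 : 0 < t := ht.1
    rw [norm_mul, mul_assoc]
    gcongr
    refine (norm_logPeriodicPow_le hC _ ht0).trans ?_
    rw [hre, show s.re - D + l - 1 = l + (s.re - D - 1) by ring, Real.rpow_add ht0,
      Real.rpow_natCast, mul_left_comm]
    have := ht.2
    gcongr

theorem zetaSum_eq (hd : IsDigitSet d) (hβ : 1 < β) {c : ℕ} (hc : rho β d ≤ c) {s : ℂ}
    (hs : Real.logb β d.card < s.re) :
    zetaSum β d s = 1 / Complex.Gamma s * upperGammaSum β d (β ^ c)⁻¹ s -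
      (β : ℂ) ^ (-(c : ℂ) * s) / Complex.Gamma (s + 1) +
      1 / Complex.Gamma s * ∑' l : ℕ, mellinTerm β d c s l := by
  have hβ0 : 0 < β := by linarith
  have hs0 : 0 < s.re := (DigitSeq.logb_card_pos hd hβ).trans hs
  have hsC : s ≠ 0 := fun h => by simp [h] at hs0
  set ε := (β ^ c)⁻¹ with hε
  have hε0 : 0 < ε := by positivity
  have hε1 : ε ≤ 1 := inv_le_one_of_one_le₀ (one_le_pow₀ hβ.le)
  have hG := Gamma_mul_zetaSum hd hβ hε0 hε1 hs
  have hΓ : Complex.Gamma s ≠ 0 := Complex.Gamma_ne_zero_of_re_pos hs0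
  have h1 : IntegrableOn (fun t : ℝ => (t : ℂ) ^ (s - 1)) (Set.Ioc 0 ε) :=
    (intervalIntegral.intervalIntegrable_cpow' (a := 0) (b := ε)
      (by rw [Complex.sub_re, Complex.one_re]; linarith)).1
  have h2 : IntegrableOn (fun t : ℝ => (seqGF β d t : ℂ) * (t : ℂ) ^ (s - 1)) (Set.Ioc 0 ε) := by
    have hlt := lt_convRadius_of_rho_le hd hβ hc
    have hD : 0 < (s - (Real.logb β d.card : ℂ)).re := by
      rw [Complex.sub_re, Complex.ofReal_re]
      linarith
    refine Integrable.mono' ((integrableOn_logPeriodicPow hd hβ hD ε).norm.const_mul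
      (∑' l, ‖taylorCoeff β d l‖ * ε ^ l)) (ContinuousOn.aestronglyMeasurable (fun t ht =>
        ContinuousAt.continuousWithinAt (ContinuousAt.mul ?_ ?_)) measurableSet_Ioc) ?_
    · exact Complex.continuous_ofReal.continuousAt.comp
        ((continuousOn_seqGF hd hβ).continuousAt (Ioi_mem_nhds ht.1))
    · exact Complex.continuousAt_ofReal_cpow_const t (s - 1) (Or.inr (ne_of_gt ht.1))
    · filter_upwards [ae_restrict_mem measurableSet_Ioc] with t ht
      have ht0 : 0 < t := ht.1
      rw [seqGF_mul_cpow hd hβ s ht0, norm_mul]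
      gcongr
      rw [← (hasSum_taylorCoeff hd hβ ht0 ((ENNReal.ofReal_le_ofReal ht.2).trans_lt hlt)).tsum_eq]
      refine tsum_of_norm_bounded (summable_norm_taylorCoeff hε0.le hlt).hasSum fun l => ?_
      rw [norm_mul, norm_pow, Complex.norm_real, Real.norm_of_nonneg ht0.le]
      have := ht.2
      gcongr
  have h3 : (∫ t in Set.Ioc 0 ε, (t : ℂ) ^ (s - 1)) = (β : ℂ) ^ (-(c : ℂ) * s) / s := by
    rw [← intervalIntegral.integral_of_le hε0.le, integral_cpow (Or.inl (by
      rw [Complex.sub_re, Complex.one_re]; linarith)), sub_add_cancel, Complex.ofReal_zero,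
      Complex.zero_cpow hsC, sub_zero]
    rw [hε, show (β ^ c)⁻¹ = β ^ (-(c : ℝ)) by rw [Real.rpow_neg hβ0.le, Real.rpow_natCast],
      ofReal_rpow_cpow hβ]
    push_cast
    rfl
  have h4 : (∫ t in Set.Ioc 0 ε, ((seqGF β d t - 1 : ℝ) : ℂ) * (t : ℂ) ^ (s - 1)) =
      (∑' l : ℕ, mellinTerm β d c s l) - (β : ℂ) ^ (-(c : ℂ) * s) / s := by
    rw [(hasSum_mellinTerm hd hβ hc hs).tsum_eq, ← h3, ← integral_sub h2 h1]
    refine integral_congr_ae (Eventually.of_forall fun t => ?_)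
    simp only
    push_cast
    ring
  rw [h4] at hG
  rw [Complex.Gamma_add_one s hsC]
  field_simp
  field_simp at hG
  linear_combination hG

/-! ### Analytic dependence of the Mellin series on s -/

theorem ofReal_ne_zero_of_one_lt (hβ : 1 < β) : (β : ℂ) ≠ 0 := by
  exact_mod_cast (by linarith : β ≠ 0)

theorem norm_cpow_mul_le (hβ : 1 < β) {x u : ℝ} {z : ℂ} (hz : z.re ≤ x) (hx : 0 ≤ x)
    (hu0 : 0 ≤ u) (hu1 : u ≤ 1) : ‖(β : ℂ) ^ (z * u)‖ ≤ β ^ x := by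
  rw [Complex.norm_cpow_eq_rpow_re_of_pos (by linarith), Complex.re_mul_ofReal]
  refine Real.rpow_le_rpow_of_exponent_le hβ.le ?_
  nlinarith

theorem differentiable_periodIntegral (hd : IsDigitSet d) (hβ : 1 < β) :
    Differentiable ℂ (periodIntegral β d) := by
  intro z₀
  have hβC := ofReal_ne_zero_of_one_lt hβ
  obtain ⟨C, hC0, hC⟩ := exists_exp_periodicP_le hd hβ
  have hE := continuous_exp_periodicP hd hβ
  have hpow : ∀ z : ℂ, Continuous fun u : ℝ => (β : ℂ) ^ (z * u) := fun z =>
    Continuous.const_cpow (by fun_prop) (Or.inl hβC)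
  have hF : ∀ z : ℂ, Continuous fun u : ℝ =>
      (Real.exp (periodicP β d u) : ℂ) * (β : ℂ) ^ (z * u) := fun z =>
    (Complex.continuous_ofReal.comp hE).mul (hpow z)
  set x := |z₀.re| + 1 with hx
  have h := intervalIntegral.hasDerivAt_integral_of_dominated_loc_of_deriv_le
    (𝕜 := ℂ) (μ := volume) (a := 0) (b := 1) (x₀ := z₀) (s := Metric.ball z₀ 1)
    (F := fun (z : ℂ) (u : ℝ) => (Real.exp (periodicP β d u) : ℂ) * (β : ℂ) ^ (z * u))
    (F' := fun (z : ℂ) (u : ℝ) => (Real.exp (periodicP β d u) : ℂ) *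
      ((β : ℂ) ^ (z * u) * Complex.log β * u))
    (bound := fun _ => C * (β ^ x * ‖Complex.log β‖))
    (Metric.ball_mem_nhds z₀ one_pos)
    (Eventually.of_forall fun z => (hF z).aestronglyMeasurable)
    ((hF z₀).intervalIntegrable _ _)
    (((Complex.continuous_ofReal.comp hE).mul
      (((hpow z₀).mul continuous_const).mul Complex.continuous_ofReal)).aestronglyMeasurable)
    (Eventually.of_forall fun u hu z hz => ?_) intervalIntegrable_const
    (Eventually.of_forall fun u hu z hz => ?_)
  · exact h.2.differentiableAt
  · rw [Set.uIoc_of_le zero_le_one] at hu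
    have h1 := Complex.abs_re_le_norm (z - z₀)
    rw [Metric.mem_ball, dist_eq_norm] at hz
    rw [Complex.sub_re] at h1
    have h2 : z.re ≤ x := by
      have := le_abs_self (z.re - z₀.re)
      have := le_abs_self z₀.re
      linarith
    have h3 := norm_cpow_mul_le hβ h2 (by positivity) hu.1.le hu.2
    rw [norm_mul, norm_mul, norm_mul, Complex.norm_real, Complex.norm_real,
      Real.norm_of_nonneg (Real.exp_pos _).le, Real.norm_of_nonneg hu.1.le]
    refine mul_le_mul (hC u) ?_ (by have := hu.1; positivity) hC0.le
    refine (mul_le_of_le_one_right (by positivity) hu.2).trans ?_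
    gcongr
  · have h1 : HasDerivAt (fun z : ℂ => z * (u : ℂ)) u z := by
      simpa using (hasDerivAt_id z).mul_const (u : ℂ)
    exact (h1.const_cpow (Or.inl hβC)).const_mul _

theorem differentiable_cpow (hβ : 1 < β) {f : ℂ → ℂ} (hf : Differentiable ℂ f) :
    Differentiable ℂ fun z => (β : ℂ) ^ f z :=
  hf.const_cpow (Or.inl (ofReal_ne_zero_of_one_lt hβ))

theorem differentiableAt_mellinKernel (hd : IsDigitSet d) (hβ : 1 < β) (c : ℕ) {z : ℂ}
    (hz : (β : ℂ) ^ z ≠ 1) : DifferentiableAt ℂ (mellinKernel β d c) z := by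
  refine DifferentiableAt.mul (DifferentiableAt.div ?_ ?_ (sub_ne_zero.2 hz))
    (differentiable_periodIntegral hd hβ z)
  · exact ((differentiable_cpow hβ (by fun_prop)).mul_const _) z
  · exact ((differentiable_cpow hβ differentiable_id).sub_const 1) z

/-- The period integral grows at most like β^{Re z}, and |β^z - 1| ≥ β^{Re z}(1 - 1/β) for Re z ≥ 1
cancels this growth. -/
theorem exists_mellinKernel_bound (hd : IsDigitSet d) (hβ : 1 < β) (c : ℕ) :
    ∃ M : ℝ, 0 ≤ M ∧ ∀ z : ℂ, 1 ≤ z.re → ‖mellinKernel β d c z‖ ≤ M * β ^ (-z.re * c) := by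
  have hβ0 : 0 < β := by linarith
  obtain ⟨C, hC0, hC⟩ := exists_exp_periodicP_le hd hβ
  have hb : 0 < 1 - β⁻¹ := sub_pos.2 (inv_lt_one_of_one_lt₀ hβ)
  have hlog : 0 ≤ Real.log β := Real.log_nonneg hβ.le
  refine ⟨Real.log β / (1 - β⁻¹) * C, by positivity, fun z hz => ?_⟩
  have h1 : ‖periodIntegral β d z‖ ≤ C * β ^ z.re := by
    have := intervalIntegral.norm_integral_le_of_norm_le_const (a := 0) (b := 1)
      (C := C * β ^ z.re) (f := fun u : ℝ =>
        (Real.exp (periodicP β d u) : ℂ) * (β : ℂ) ^ (z * u)) fun u hu => by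
      rw [Set.uIoc_of_le zero_le_one] at hu
      rw [norm_mul, Complex.norm_real, Real.norm_of_nonneg (Real.exp_pos _).le]
      exact mul_le_mul (hC u) (norm_cpow_mul_le hβ le_rfl (by linarith) hu.1.le hu.2)
        (norm_nonneg _) hC0.le
    simpa [periodIntegral] using this
  have h2 : β ^ z.re * (1 - β⁻¹) ≤ ‖(β : ℂ) ^ z - 1‖ := by
    have h3 := norm_sub_norm_le ((β : ℂ) ^ z) 1
    rw [norm_one, Complex.norm_cpow_eq_rpow_re_of_pos hβ0] at h3
    have h4 : 1 ≤ β ^ z.re * β⁻¹ := by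
      rw [← div_eq_mul_inv, one_le_div hβ0]
      exact (Real.rpow_one β).symm.le.trans (Real.rpow_le_rpow_of_exponent_le hβ.le hz)
    linarith
  have hp : 0 < β ^ z.re := by positivity
  rw [mellinKernel, norm_mul, norm_div, norm_mul, Complex.norm_cpow_eq_rpow_re_of_pos hβ0,
    Complex.norm_real, Real.norm_of_nonneg hlog]
  have e : (-z * (c : ℂ)).re = -z.re * c := by simp
  rw [e]
  calc β ^ (-z.re * c) * Real.log β / ‖(β : ℂ) ^ z - 1‖ * ‖periodIntegral β d z‖
      ≤ β ^ (-z.re * c) * Real.log β / (β ^ z.re * (1 - β⁻¹)) * (C * β ^ z.re) := by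
        gcongr
    _ = Real.log β / (1 - β⁻¹) * C * β ^ (-z.re * c) := by
        field_simp

/-- Near a given point only finitely many terms can be singular; the remaining ones are dominated by
a multiple of |c(ℓ)|β^{-cℓ}. -/
theorem exists_mellinTail_bound (hd : IsDigitSet d) (hβ : 1 < β) {c : ℕ} (hc : rho β d ≤ c)
    (s₀ : ℂ) : ∃ L : ℕ, ∃ u : ℕ → ℝ, Summable u ∧ ∀ s ∈ Metric.ball s₀ 1, ∀ l : ℕ,
      1 ≤ (s + ((l + L : ℕ) : ℂ) - (Real.logb β d.card : ℂ)).re ∧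
      ‖taylorCoeff β d (l + L)‖ *
        ‖mellinKernel β d c (s + ((l + L : ℕ) : ℂ) - (Real.logb β d.card : ℂ))‖ ≤ u l := by
  have hβ0 : 0 < β := by linarith
  set D := Real.logb β d.card with hD
  -- One unit covers the ball of radius 1 around `s₀`, the other ensures Re z ≥ 1.
  obtain ⟨L, hL⟩ := exists_nat_ge (2 + D - s₀.re)
  obtain ⟨M, hM0, hM⟩ := exists_mellinKernel_bound hd hβ c
  set ε := (β ^ c)⁻¹ with hε
  have hε0 : 0 < ε := by positivity
  refine ⟨L, fun l => M * β ^ (-(s₀.re - 1 - D) * c) * (‖taylorCoeff β d (l + L)‖ * ε ^ (l + L)),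
    ((summable_nat_add_iff L).2
      (summable_norm_taylorCoeff hε0.le (lt_convRadius_of_rho_le hd hβ hc))).mul_left _,
    fun s hs l => ?_⟩
  have h1 := Complex.abs_re_le_norm (s - s₀)
  rw [Metric.mem_ball, dist_eq_norm] at hs
  rw [Complex.sub_re] at h1
  have h2 := neg_abs_le (s.re - s₀.re)
  have hre : (s + ((l + L : ℕ) : ℂ) - (D : ℂ)).re = s.re + (l + L : ℕ) - D := by simp
  have hl : (0 : ℝ) ≤ l := l.cast_nonneg
  have hge : 1 ≤ (s + ((l + L : ℕ) : ℂ) - (D : ℂ)).re := by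
    rw [hre]
    push_cast
    linarith
  refine ⟨hge, ?_⟩
  have hεr : ε ^ (l + L) = β ^ (-((l + L : ℕ) : ℝ) * c) := by
    rw [hε, ← Real.rpow_natCast β c, ← Real.rpow_neg hβ0.le, ← Real.rpow_natCast,
      ← Real.rpow_mul hβ0.le]
    congr 1
    ring
  have h3 : β ^ (-(s + ((l + L : ℕ) : ℂ) - (D : ℂ)).re * c) ≤
      β ^ (-(s₀.re - 1 - D) * c) * ε ^ (l + L) := by
    rw [hεr, ← Real.rpow_add hβ0, hre]
    refine Real.rpow_le_rpow_of_exponent_le hβ.le ?_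
    have hc0 : (0 : ℝ) ≤ c := c.cast_nonneg
    nlinarith
  calc ‖taylorCoeff β d (l + L)‖ * ‖mellinKernel β d c (s + ((l + L : ℕ) : ℂ) - (D : ℂ))‖
      ≤ ‖taylorCoeff β d (l + L)‖ * (M * (β ^ (-(s₀.re - 1 - D) * c) * ε ^ (l + L))) := by
        gcongr
        exact (hM _ hge).trans (by gcongr)
    _ = _ := by ring

/-- The series `∑ a(ℓ) K(s + ℓ - D)`. -/
noncomputable def mellinSeries (β : ℝ) (d : Finset ℝ) (c : ℕ) (a : ℕ → ℂ) (s : ℂ) : ℂ :=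
  ∑' l : ℕ, a l * mellinKernel β d c (s + l - (Real.logb β d.card : ℂ))

theorem summable_mellinSeries (hd : IsDigitSet d) (hβ : 1 < β) {c : ℕ} (hc : rho β d ≤ c)
    {a : ℕ → ℂ} (ha : ∀ l, ‖a l‖ ≤ ‖taylorCoeff β d l‖) (s : ℂ) :
    Summable fun l : ℕ => a l * mellinKernel β d c (s + l - (Real.logb β d.card : ℂ)) := by
  obtain ⟨L, u, hu, h⟩ := exists_mellinTail_bound hd hβ hc s
  refine (summable_nat_add_iff L).1 (Summable.of_norm_bounded hu fun l => ?_)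
  rw [norm_mul]
  exact (mul_le_mul_of_nonneg_right (ha _) (norm_nonneg _)).trans
    (h s (Metric.mem_ball_self one_pos) l).2

theorem eventually_cpow_ne_one (hd : IsDigitSet d) (hβ : 1 < β) (s₀ : ℂ) :
    ∀ᶠ s in 𝓝 s₀, ∀ l : ℕ, (β : ℂ) ^ (s₀ + l - (Real.logb β d.card : ℂ)) ≠ 1 →
      (β : ℂ) ^ (s + l - (Real.logb β d.card : ℂ)) ≠ 1 := by
  obtain ⟨L, u, hu, h⟩ := exists_mellinTail_bound hd hβ (le_refl (rho β d)) s₀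
  have h1 : ∀ᶠ s in 𝓝 s₀, ∀ l ∈ Finset.range L,
      (β : ℂ) ^ (s₀ + l - (Real.logb β d.card : ℂ)) ≠ 1 →
      (β : ℂ) ^ (s + l - (Real.logb β d.card : ℂ)) ≠ 1 := by
    rw [Filter.eventually_all_finset]
    intro l _
    by_cases hl : (β : ℂ) ^ (s₀ + l - (Real.logb β d.card : ℂ)) = 1
    · exact Eventually.of_forall fun s hs => absurd hl hs
    · have hcont : Continuous fun s : ℂ => (β : ℂ) ^ (s + l - (Real.logb β d.card : ℂ)) :=
        (differentiable_cpow hβ (by fun_prop)).continuous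
      filter_upwards [hcont.continuousAt.eventually_ne hl] with s hs _ using hs
  filter_upwards [h1, Metric.ball_mem_nhds s₀ one_pos] with s hs hball l hl
  by_cases hlL : l < L
  · exact hs l (Finset.mem_range.2 hlL) hl
  · obtain ⟨m, rfl⟩ : ∃ m, l = m + L := ⟨l - L, by omega⟩
    exact cpow_ne_one hβ (by have := (h s hball m).1; linarith)

/-- General coefficients are allowed so that, at a pole, the single singular term can be deleted. -/
theorem analyticAt_mellinSeries (hd : IsDigitSet d) (hβ : 1 < β) {c : ℕ} (hc : rho β d ≤ c)
    {a : ℕ → ℂ} (ha : ∀ l, ‖a l‖ ≤ ‖taylorCoeff β d l‖) {s₀ : ℂ}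
    (h0 : ∀ l : ℕ, a l = 0 ∨ (β : ℂ) ^ (s₀ + l - (Real.logb β d.card : ℂ)) ≠ 1) :
    AnalyticAt ℂ (mellinSeries β d c a) s₀ := by
  obtain ⟨L, u, hu, h⟩ := exists_mellinTail_bound hd hβ hc s₀
  obtain ⟨V, hV, hVo, hsV⟩ := eventually_nhds_iff.1 (eventually_cpow_ne_one hd hβ s₀)
  have hterm : ∀ l : ℕ, DifferentiableOn ℂ
      (fun s => a l * mellinKernel β d c (s + l - (Real.logb β d.card : ℂ)))
      (Metric.ball s₀ 1 ∩ V) := by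
    intro l s hs
    rcases h0 l with h0 | h0
    · simp only [h0, zero_mul]
      exact differentiableWithinAt_const _
    · have h1 := differentiableAt_mellinKernel hd hβ c (hV s hs.2 l h0)
      have h2 : DifferentiableAt ℂ (fun s : ℂ => s + l - (Real.logb β d.card : ℂ)) s := by fun_prop
      exact (DifferentiableAt.const_mul (DifferentiableAt.comp s h1 h2) _).differentiableWithinAt
  have hopen : IsOpen (Metric.ball s₀ 1 ∩ V) := Metric.isOpen_ball.inter hVo
  have htail : DifferentiableOn ℂ (fun s => ∑' l : ℕ, a (l + L) *
      mellinKernel β d c (s + ((l + L : ℕ) : ℂ) - (Real.logb β d.card : ℂ)))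
      (Metric.ball s₀ 1 ∩ V) := by
    refine Complex.differentiableOn_tsum_of_summable_norm hu (fun l => hterm (l + L)) hopen
      fun l s hs => ?_
    rw [norm_mul]
    exact (mul_le_mul_of_nonneg_right (ha _) (norm_nonneg _)).trans (h s hs.1 l).2
  have hsum := (DifferentiableOn.fun_sum (u := Finset.range L) fun l _ => hterm l).add htail
  refine DifferentiableOn.analyticAt (s := Metric.ball s₀ 1 ∩ V) (hsum.congr fun s _ => ?_)
    (hopen.mem_nhds ⟨Metric.mem_ball_self one_pos, hsV⟩)
  exact ((summable_mellinSeries hd hβ hc ha s).sum_add_tsum_nat_add L).symm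

/-! ### The continuation off the possible poles -/

/-- The right-hand side of the explicit formula. -/
noncomputable def zetaCont (β : ℝ) (d : Finset ℝ) (c : ℕ) (s : ℂ) : ℂ :=
  1 / Complex.Gamma s * upperGammaSum β d (β ^ c)⁻¹ s -
    (β : ℂ) ^ (-(c : ℂ) * s) / Complex.Gamma (s + 1) +
    1 / Complex.Gamma s * mellinSeries β d c (taylorCoeff β d) s

/-- The part of the explicit formula without the Mellin series. -/
noncomputable def zetaEntire (β : ℝ) (d : Finset ℝ) (c : ℕ) (s : ℂ) : ℂ :=
  (Complex.Gamma s)⁻¹ * upperGammaSum β d (β ^ c)⁻¹ s -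
    (β : ℂ) ^ (-(c : ℂ) * s) * (Complex.Gamma (s + 1))⁻¹

theorem zetaCont_eq (β : ℝ) (d : Finset ℝ) (c : ℕ) (s : ℂ) :
    zetaCont β d c s = zetaEntire β d c s +
      (Complex.Gamma s)⁻¹ * mellinSeries β d c (taylorCoeff β d) s := by
  rw [zetaCont, zetaEntire, one_div, div_eq_mul_inv]

theorem differentiable_zetaEntire (hd : IsDigitSet d) (hβ : 1 < β) (c : ℕ) :
    Differentiable ℂ (zetaEntire β d c) := by
  have hΓ : Differentiable ℂ fun s : ℂ => (Complex.Gamma (s + 1))⁻¹ :=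
    Complex.differentiable_one_div_Gamma.comp (differentiable_id.add_const 1)
  refine (Complex.differentiable_one_div_Gamma.mul ?_).sub
    ((differentiable_cpow hβ (by fun_prop)).mul hΓ)
  exact differentiable_upperGammaSum hd hβ (by positivity)
    (inv_le_one_of_one_le₀ (one_le_pow₀ hβ.le))

/-- The complement of the possible poles. -/
def regularSet (β : ℝ) (d : Finset ℝ) : Set ℂ :=
  {s | ∀ l : ℕ, (β : ℂ) ^ (s + l - (Real.logb β d.card : ℂ)) ≠ 1}

theorem isOpen_regularSet (hd : IsDigitSet d) (hβ : 1 < β) : IsOpen (regularSet β d) := by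
  refine isOpen_iff_mem_nhds.2 fun s hs => ?_
  filter_upwards [eventually_cpow_ne_one hd hβ s] with t ht l using ht l (hs l)

theorem cpow_eq_one_iff (hβ : 1 < β) (s : ℂ) (j : ℕ) :
    (β : ℂ) ^ (s + j - (Real.logb β d.card : ℂ)) = 1 ↔ ∃ k : ℤ, s = polePoint β d j k := by
  have hlog : (Real.log β : ℂ) ≠ 0 := by exact_mod_cast (Real.log_pos hβ).ne'
  rw [Complex.cpow_def_of_ne_zero (ofReal_ne_zero_of_one_lt hβ), Complex.exp_eq_one_iff,
    ← Complex.ofReal_log (by linarith)]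
  constructor
  · rintro ⟨n, hn⟩
    refine ⟨-n, ?_⟩
    rw [polePoint]
    push_cast
    field_simp
    linear_combination hn
  · rintro ⟨k, rfl⟩
    refine ⟨-k, ?_⟩
    rw [polePoint]
    push_cast
    field_simp
    ring

theorem mem_regularSet_iff (hβ : 1 < β) (s : ℂ) :
    s ∈ regularSet β d ↔ ∀ (j : ℕ) (k : ℤ), s ≠ polePoint β d j k := by
  simp only [regularSet, Set.mem_ofPred_eq, Ne, cpow_eq_one_iff hβ, not_exists]

/-- The complement of a countable set in the plane is path connected. -/
theorem isPreconnected_regularSet (hβ : 1 < β) : IsPreconnected (regularSet β d) := by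
  have hcount : ((regularSet β d)ᶜ).Countable := by
    refine (Set.countable_range fun p : ℕ × ℤ => polePoint β d p.1 p.2).mono fun s hs => ?_
    rw [Set.mem_compl_iff, mem_regularSet_iff hβ] at hs
    push Not at hs
    obtain ⟨j, k, h⟩ := hs
    exact ⟨(j, k), h.symm⟩
  have := hcount.isPathConnected_compl_of_one_lt_rank (by
    rw [Complex.rank_real_complex]
    exact Nat.one_lt_ofNat)
  rw [compl_compl] at this
  exact this.isConnected.isPreconnected

theorem mem_regularSet_of_lt (hβ : 1 < β) {s : ℂ} (hs : Real.logb β d.card < s.re) :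
    s ∈ regularSet β d := fun l => cpow_ne_one hβ (by
  have : (0 : ℝ) ≤ l := l.cast_nonneg
  simp only [Complex.sub_re, Complex.add_re, Complex.natCast_re, Complex.ofReal_re]
  linarith)

theorem analyticAt_zetaCont (hd : IsDigitSet d) (hβ : 1 < β) {c : ℕ} (hc : rho β d ≤ c) {s : ℂ}
    (hs : s ∈ regularSet β d) : AnalyticAt ℂ (zetaCont β d c) s := by
  rw [funext (zetaCont_eq β d c)]
  exact ((differentiable_zetaEntire hd hβ c).analyticAt s).add
    ((Complex.differentiable_one_div_Gamma.analyticAt s).mul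
      (analyticAt_mellinSeries hd hβ hc (fun l => le_rfl) fun l => Or.inr (hs l)))

theorem zetaCont_eq_zetaSum (hd : IsDigitSet d) (hβ : 1 < β) {c : ℕ} (hc : rho β d ≤ c) {s : ℂ}
    (hs : Real.logb β d.card < s.re) : zetaCont β d c s = zetaSum β d s := by
  rw [zetaSum_eq hd hβ hc hs, zetaCont, mellinSeries]
  simp only [mellinTerm_eq]

/-- Both sides equal the Dirichlet-type series for Re s > D, and the identity theorem spreads the
equality. -/
theorem zetaCont_eq_zetaCont (hd : IsDigitSet d) (hβ : 1 < β) {c c' : ℕ} (hc : rho β d ≤ c)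
    (hc' : rho β d ≤ c') : Set.EqOn (zetaCont β d c) (zetaCont β d c') (regularSet β d) := by
  have hs0 : Real.logb β d.card < (((Real.logb β d.card + 1 : ℝ) : ℂ)).re := by
    rw [Complex.ofReal_re]
    linarith
  refine AnalyticOnNhd.eqOn_of_preconnected_of_eventuallyEq (𝕜 := ℂ)
    (fun s hs => analyticAt_zetaCont hd hβ hc hs) (fun s hs => analyticAt_zetaCont hd hβ hc' hs)
    (isPreconnected_regularSet hβ) (mem_regularSet_of_lt hβ hs0) ?_
  filter_upwards [(isOpen_lt continuous_const Complex.continuous_re).mem_nhds hs0] with s hs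
  rw [zetaCont_eq_zetaSum hd hβ hc hs, zetaCont_eq_zetaSum hd hβ hc' hs]

/-- β^z = 1 forces Re z = 0, which determines ℓ; hence poles from different ℓ never collide. -/
theorem cpow_natCast_sub_ne_one (hβ : 1 < β) {p : ℂ} {j l : ℕ} (hlj : l ≠ j)
    (hp : (β : ℂ) ^ (p + j - (Real.logb β d.card : ℂ)) = 1) :
    (β : ℂ) ^ (p + l - (Real.logb β d.card : ℂ)) ≠ 1 := by
  intro h
  have hβ0 : 0 < β := by linarith
  have h1 := congrArg norm h
  have h2 := congrArg norm hp
  rw [Complex.norm_cpow_eq_rpow_re_of_pos hβ0, norm_one] at h1 h2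
  have h3 := (Real.strictMono_rpow_of_base_gt_one hβ).injective (h1.trans h2.symm)
  simp only [Complex.sub_re, Complex.add_re, Complex.natCast_re, Complex.ofReal_re] at h3
  exact hlj (by exact_mod_cast (by linarith : (l : ℝ) = j))

/-! ### Poles and values at nonpositive integers -/

/-- The behaviour of the continuation near a possible pole. -/
theorem exists_zetaCont_eq_near_pole (hd : IsDigitSet d) (hβ : 1 < β) {c : ℕ} (hc : rho β d ≤ c)
    {p : ℂ} {j : ℕ} (hp : (β : ℂ) ^ (p + j - (Real.logb β d.card : ℂ)) = 1) :
    ∃ W A : ℂ → ℂ, AnalyticAt ℂ W p ∧ AnalyticAt ℂ A p ∧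
      W p = taylorCoeff β d j * periodIntegral β d (p + j - (Real.logb β d.card : ℂ)) ∧
      (Complex.Gamma p = 0 → A p = zetaEntire β d c p) ∧
      ∀ s, s ≠ p → zetaCont β d c s = (s - p)⁻¹ * (W s * (Complex.Gamma s)⁻¹) + A s := by
  set D := Real.logb β d.card with hD
  have hβC := ofReal_ne_zero_of_one_lt hβ
  have hlog : Complex.log β ≠ 0 := by
    rw [← Complex.ofReal_log (by linarith)]
    exact_mod_cast (Real.log_pos hβ).ne'
  let B : ℂ → ℂ := fun s => (β : ℂ) ^ (s + j - (D : ℂ)) - 1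
  have hB : Differentiable ℂ B := (differentiable_cpow hβ (by fun_prop)).sub_const 1
  have hBp : B p = 0 := by simp only [B, hp, sub_self]
  -- The denominator factors as (s - p)q(s) with q entire and q(p) = log β ≠ 0, so its zero is
  -- simple.
  let q : ℂ → ℂ := dslope B p
  have hq : Differentiable ℂ q := fun s =>
    ((Complex.differentiableOn_dslope univ_mem).2 hB.differentiableOn).differentiableAt univ_mem
  have hqp : q p = Complex.log β := by
    have h1 : HasDerivAt (fun s : ℂ => s + (j : ℂ) - (D : ℂ)) 1 p :=
      ((hasDerivAt_id p).add_const _).sub_const _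
    have h2 := (h1.const_cpow (c := (β : ℂ)) (Or.inl hβC)).sub_const 1
    rw [hp, one_mul, mul_one] at h2
    simp only [q, dslope_same]
    exact h2.deriv
  have hBq : ∀ s, B s = (s - p) * q s := fun s => by
    have := sub_smul_dslope B p s
    rw [hBp, sub_zero, smul_eq_mul] at this
    exact this.symm
  let W : ℂ → ℂ := fun s => taylorCoeff β d j * ((β : ℂ) ^ (-(s + j - (D : ℂ)) * c) *
    (Real.log β : ℂ) / q s * periodIntegral β d (s + j - (D : ℂ)))
  let a : ℕ → ℂ := fun l => if l = j then 0 else taylorCoeff β d l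
  have ha : ∀ l, ‖a l‖ ≤ ‖taylorCoeff β d l‖ := fun l => by
    simp only [a]
    split_ifs
    · rw [norm_zero]
      exact norm_nonneg _
    · exact le_rfl
  have hanal : AnalyticAt ℂ (mellinSeries β d c a) p := by
    refine analyticAt_mellinSeries hd hβ hc ha fun l => ?_
    by_cases hl : l = j
    · exact Or.inl (if_pos hl)
    · exact Or.inr (cpow_natCast_sub_ne_one hβ hl hp)
  refine ⟨W, fun s => zetaEntire β d c s + (Complex.Gamma s)⁻¹ * mellinSeries β d c a s,
    ?_, ?_, ?_, ?_, ?_⟩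
  · have h1 : Differentiable ℂ fun s : ℂ =>
        (β : ℂ) ^ (-(s + j - (D : ℂ)) * c) * (Real.log β : ℂ) :=
      (differentiable_cpow hβ (by fun_prop)).mul_const _
    have h2 : Differentiable ℂ fun s : ℂ => periodIntegral β d (s + j - (D : ℂ)) :=
      (differentiable_periodIntegral hd hβ).comp (by fun_prop)
    exact analyticAt_const.mul (((h1.analyticAt p).div (hq.analyticAt p) (by rwa [hqp])).mul
      (h2.analyticAt p))
  · exact ((differentiable_zetaEntire hd hβ c).analyticAt p).add
      ((Complex.differentiable_one_div_Gamma.analyticAt p).mul hanal)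
  -- Since β^z = 1 at the pole, the dependence on c disappears, and log β cancels against q(p).
  · have h1 : (β : ℂ) ^ (-(p + j - (D : ℂ)) * c) = 1 := by
      rw [mul_comm, Complex.cpow_nat_mul, Complex.cpow_neg, hp, inv_one, one_pow]
    simp only [W]
    rw [h1, hqp, one_mul, Complex.ofReal_log (by linarith), div_self hlog, one_mul]
  · intro h
    simp only [h, inv_zero, zero_mul, add_zero]
  · intro s hs
    have h1 := (summable_mellinSeries hd hβ hc (fun l => le_rfl) s).tsum_eq_add_tsum_ite j
    have h2 : mellinKernel β d c (s + j - (D : ℂ)) = (s - p)⁻¹ *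
        ((β : ℂ) ^ (-(s + j - (D : ℂ)) * c) * (Real.log β : ℂ) / q s *
          periodIntegral β d (s + j - (D : ℂ))) := by
      rw [mellinKernel, show (β : ℂ) ^ (s + j - (D : ℂ)) - 1 = (s - p) * q s from hBq s,
        div_eq_mul_inv, mul_inv]
      ring
    have h3 : mellinSeries β d c (taylorCoeff β d) s = (s - p)⁻¹ * W s + mellinSeries β d c a s := by
      rw [mellinSeries, h1, h2, mellinSeries]
      congr 1
      · simp only [W]
        ring
      · refine tsum_congr fun l => ?_
        simp only [a]
        split_ifs
        · rw [zero_mul]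
        · rfl
    rw [zetaCont_eq, h3]
    ring

/-- Differentiate 1/Γ(s) = s/Γ(s + 1) and descend from s = 0 by induction. -/
theorem deriv_one_div_Gamma_neg_nat (n : ℕ) :
    deriv (fun s : ℂ => (Complex.Gamma s)⁻¹) (-(n : ℂ)) = (-1) ^ n * n.factorial := by
  have hrec : ∀ s : ℂ, deriv (fun s : ℂ => (Complex.Gamma s)⁻¹) s =
      (Complex.Gamma (s + 1))⁻¹ + s * deriv (fun s : ℂ => (Complex.Gamma s)⁻¹) (s + 1) := by
    intro s
    have h1 := (Complex.differentiable_one_div_Gamma (s + 1)).hasDerivAt.comp_add_const s 1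
    have h2 := (hasDerivAt_id s).mul h1
    have h3 : HasDerivAt (fun s : ℂ => (Complex.Gamma s)⁻¹)
        (1 * (Complex.Gamma (s + 1))⁻¹ +
          s * deriv (fun s : ℂ => (Complex.Gamma s)⁻¹) (s + 1)) s := by
      convert! h2 using 1
      funext t
      exact Complex.one_div_Gamma_eq_self_mul_one_div_Gamma_add_one t
    rw [h3.deriv, one_mul]
  induction n with
  | zero =>
    rw [hrec]
    simp
  | succ n ih =>
    rw [hrec, show -((n + 1 : ℕ) : ℂ) + 1 = -(n : ℂ) by push_cast; ring, ih,
      Complex.Gamma_neg_nat_eq_zero, Nat.factorial_succ]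
    push_cast
    ring

theorem zetaEntire_neg_nat (β : ℝ) (d : Finset ℝ) (c n : ℕ) :
    zetaEntire β d c (-(n : ℂ)) = -(if n = 0 then 1 else 0) := by
  rw [zetaEntire, Complex.Gamma_neg_nat_eq_zero]
  cases n with
  | zero => simp
  | succ n =>
    rw [show -((n + 1 : ℕ) : ℂ) + 1 = -(n : ℂ) by push_cast; ring,
      Complex.Gamma_neg_nat_eq_zero]
    simp

open Classical in
/-- The meromorphic continuation of the zeta function, with removable singularities removed. -/
noncomputable def zetaMero (β : ℝ) (d : Finset ℝ) (s : ℂ) : ℂ :=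
  if s ∈ regularSet β d then zetaCont β d (rho β d) s
  else limUnder (𝓝[≠] s) (zetaCont β d (rho β d))

theorem zetaMero_eq (hd : IsDigitSet d) (hβ : 1 < β) {c : ℕ} (hc : rho β d ≤ c) {s : ℂ}
    (hs : s ∈ regularSet β d) : zetaMero β d s = zetaCont β d c s := by
  rw [zetaMero, if_pos hs, zetaCont_eq_zetaCont hd hβ le_rfl hc hs]

theorem analyticAt_zetaMero (hd : IsDigitSet d) (hβ : 1 < β) {s : ℂ} (hs : s ∈ regularSet β d) :
    AnalyticAt ℂ (zetaMero β d) s := by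
  refine (analyticAt_zetaCont hd hβ (le_refl (rho β d)) hs).congr ?_
  filter_upwards [(isOpen_regularSet hd hβ).mem_nhds hs] with t ht
  exact (zetaMero_eq hd hβ le_rfl ht).symm

/-- The singular denominator has nonzero derivative at p, so its zero is isolated; the other
denominators stay nonzero nearby. -/
theorem eventually_mem_regularSet (hd : IsDigitSet d) (hβ : 1 < β) {p : ℂ} {j : ℕ}
    (hp : (β : ℂ) ^ (p + j - (Real.logb β d.card : ℂ)) = 1) :
    ∀ᶠ s in 𝓝[≠] p, s ∈ regularSet β d := by
  have hβC := ofReal_ne_zero_of_one_lt hβ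
  have h1 : HasDerivAt (fun s : ℂ => s + (j : ℂ) - (Real.logb β d.card : ℂ)) 1 p :=
    ((hasDerivAt_id p).add_const _).sub_const _
  have h2 := h1.const_cpow (c := (β : ℂ)) (Or.inl hβC)
  have h3 : (1 : ℂ) * Complex.log β * 1 ≠ 0 := by
    rw [one_mul, mul_one, ← Complex.ofReal_log (by linarith)]
    exact_mod_cast (Real.log_pos hβ).ne'
  rw [hp] at h2
  filter_upwards [h2.eventually_ne h3 (c := 1),
    (eventually_cpow_ne_one hd hβ p).filter_mono nhdsWithin_le_nhds] with s hs hs2 l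
  by_cases hl : l = j
  · rw [hl]
    exact hs
  · exact hs2 l (cpow_natCast_sub_ne_one hβ hl hp)

theorem exists_zetaMero_eq_near_pole (hd : IsDigitSet d) (hβ : 1 < β)
    {p : ℂ} {j : ℕ} (hp : (β : ℂ) ^ (p + j - (Real.logb β d.card : ℂ)) = 1) :
    ∃ W A : ℂ → ℂ, AnalyticAt ℂ W p ∧ AnalyticAt ℂ A p ∧
      W p = taylorCoeff β d j * periodIntegral β d (p + j - (Real.logb β d.card : ℂ)) ∧
      (Complex.Gamma p = 0 → A p = zetaEntire β d (rho β d) p) ∧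
      zetaMero β d =ᶠ[𝓝[≠] p] fun s => (s - p)⁻¹ * (W s * (Complex.Gamma s)⁻¹) + A s := by
  obtain ⟨W, A, hW, hA, hWp, hAp, h⟩ := exists_zetaCont_eq_near_pole hd hβ (le_refl (rho β d)) hp
  refine ⟨W, A, hW, hA, hWp, hAp, ?_⟩
  filter_upwards [eventually_mem_regularSet hd hβ hp, self_mem_nhdsWithin] with s hs hsp
  rw [zetaMero_eq hd hβ le_rfl hs, h s hsp]

theorem tendsto_sub_mul_zetaMero (hd : IsDigitSet d) (hβ : 1 < β) {p : ℂ} {j : ℕ}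
    (hp : (β : ℂ) ^ (p + j - (Real.logb β d.card : ℂ)) = 1) :
    -1 ≤ meromorphicOrderAt (zetaMero β d) p ∧ MeromorphicAt (zetaMero β d) p ∧
    Tendsto (fun s => (s - p) * zetaMero β d s) (𝓝[≠] p)
      (𝓝 (taylorCoeff β d j / Complex.Gamma p *
        periodIntegral β d (p + j - (Real.logb β d.card : ℂ)))) := by
  obtain ⟨W, A, hW, hA, hWp, -, h⟩ := exists_zetaMero_eq_near_pole hd hβ hp
  let X : ℂ → ℂ := fun s => W s * (Complex.Gamma s)⁻¹ + (s - p) * A s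
  have hX : AnalyticAt ℂ X p :=
    (hW.mul (Complex.differentiable_one_div_Gamma.analyticAt p)).add
      ((analyticAt_id.sub analyticAt_const).mul hA)
  have h' : zetaMero β d =ᶠ[𝓝[≠] p] (fun s => (s - p)⁻¹) * X := by
    filter_upwards [h, self_mem_nhdsWithin] with s hs hsp
    have : s - p ≠ 0 := sub_ne_zero.2 hsp
    rw [hs, Pi.mul_apply]
    simp only [X]
    field_simp
  have hsub : AnalyticAt ℂ (fun s : ℂ => s - p) p := analyticAt_id.sub analyticAt_const
  have hinv : MeromorphicAt (fun s : ℂ => (s - p)⁻¹) p := hsub.meromorphicAt.inv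
  refine ⟨?_, (hinv.mul hX.meromorphicAt).congr h'.symm, ?_⟩
  · rw [meromorphicOrderAt_congr h', meromorphicOrderAt_mul hinv hX.meromorphicAt]
    have h1 : meromorphicOrderAt (fun s : ℂ => (s - p)⁻¹) p = ((-1 : ℤ) : WithTop ℤ) := by
      refine (meromorphicOrderAt_eq_int_iff hinv).2 ⟨fun _ => 1, analyticAt_const, one_ne_zero, ?_⟩
      exact Eventually.of_forall fun s => by simp
    rw [h1]
    exact le_add_of_nonneg_right hX.meromorphicOrderAt_nonneg
  · have hXp : X p = taylorCoeff β d j / Complex.Gamma p *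
        periodIntegral β d (p + j - (Real.logb β d.card : ℂ)) := by
      simp only [X]
      rw [hWp, sub_self, zero_mul, add_zero]
      ring
    rw [← hXp]
    refine (hX.continuousAt.tendsto.mono_left nhdsWithin_le_nhds).congr' ?_
    filter_upwards [h', self_mem_nhdsWithin] with s hs hsp
    rw [hs, Pi.mul_apply, mul_inv_cancel_left₀ (sub_ne_zero.2 hsp)]

/-- The zero of 1/Γ at -n absorbs the factor (s - p)^{-1}, leaving W times the derivative of 1/Γ
plus the regular part. -/
theorem zetaMero_neg_nat_of_pole (hd : IsDigitSet d) (hβ : 1 < β) {n j : ℕ}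
    (hp : (β : ℂ) ^ (-(n : ℂ) + j - (Real.logb β d.card : ℂ)) = 1) :
    AnalyticAt ℂ (zetaMero β d) (-(n : ℂ)) ∧ zetaMero β d (-(n : ℂ)) =
      (-1) ^ n * n.factorial * taylorCoeff β d j *
        periodIntegral β d (-(n : ℂ) + j - (Real.logb β d.card : ℂ)) -
        (if n = 0 then 1 else 0) := by
  set p : ℂ := -(n : ℂ) with hpn
  obtain ⟨W, A, hW, hA, hWp, hAp, h⟩ := exists_zetaMero_eq_near_pole hd hβ hp
  have hΓ : Complex.Gamma p = 0 := Complex.Gamma_neg_nat_eq_zero n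
  let R : ℂ → ℂ := fun s => (Complex.Gamma s)⁻¹
  have hR : Differentiable ℂ R := Complex.differentiable_one_div_Gamma
  have hRd : Differentiable ℂ (dslope R p) := fun s =>
    ((Complex.differentiableOn_dslope univ_mem).2 hR.differentiableOn).differentiableAt univ_mem
  let Y : ℂ → ℂ := fun s => W s * dslope R p s + A s
  have hY : AnalyticAt ℂ Y p := (hW.mul (hRd.analyticAt p)).add hA
  have hYeq : zetaMero β d =ᶠ[𝓝[≠] p] Y := by
    filter_upwards [h, self_mem_nhdsWithin] with s hs hsp
    have h1 := sub_smul_dslope R p s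
    have h2 : R p = 0 := by simp only [R, hΓ, inv_zero]
    rw [h2, sub_zero, smul_eq_mul] at h1
    have h3 : s - p ≠ 0 := sub_ne_zero.2 hsp
    rw [hs, show (Complex.Gamma s)⁻¹ = (s - p) * dslope R p s from h1.symm]
    simp only [Y]
    field_simp
  have hnot : p ∉ regularSet β d := fun hmem => hmem j hp
  have hval : zetaMero β d p = Y p := by
    rw [zetaMero, if_neg hnot]
    -- The value assigned at p is a limit by definition, so it equals the analytic extension Y(p).
    refine Tendsto.limUnder_eq ((hY.continuousAt.tendsto.mono_left nhdsWithin_le_nhds).congr' ?_)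
    filter_upwards [hYeq, eventually_mem_regularSet hd hβ hp] with s hs hmem
    rw [← hs, zetaMero_eq hd hβ le_rfl hmem]
  refine ⟨hY.congr ?_, ?_⟩
  · filter_upwards [eventually_nhdsWithin_iff.1 hYeq] with s hs
    by_cases hsp : s = p
    · rw [hsp, hval]
    · exact (hs hsp).symm
  · rw [hval]
    simp only [Y, dslope_same]
    rw [hWp, hAp hΓ, hpn, zetaEntire_neg_nat]
    simp only [R]
    rw [deriv_one_div_Gamma_neg_nat]
    ring

end

end NumerationZeta
-- Assembly of the theorem
open NumerationZeta in
theorem theorem3p1 (β : ℝ) (hβ : 1 < β) (d : Finset ℝ) (hd0 : (0 : ℝ) ∈ d)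
    (hdnn : ∀ δ ∈ d, 0 ≤ δ) (hd2 : 2 ≤ d.card) :
    ∃ Z : ℂ → ℂ,
      -- `Z` is a meromorphic continuation of the zeta function
      Meromorphic Z ∧
      (∀ s : ℂ, Real.logb β d.card < s.re →
        HasSum (fun x => zetaTerm (fun k => β ^ k) d s x) (Z s)) ∧
      -- holomorphy away from the listed points
      (∀ s : ℂ, (∀ (j : ℕ) (k : ℤ), s ≠ polePoint β d j k) → AnalyticAt ℂ Z s) ∧
      -- the explicit formula
      (∀ c : ℕ, rho β d ≤ c → ∀ s : ℂ, (∀ (j : ℕ) (k : ℤ), s ≠ polePoint β d j k) →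
        Summable (fun x : Set.Ioi (0 : ℝ) =>
          zetaTerm (fun k => β ^ k) d s x * upperGamma s ((x : ℝ) * (β ^ c)⁻¹)) ∧
        Summable (fun l : ℕ => mellinTerm β d c s l) ∧
        Z s =
          1 / Complex.Gamma s *
              (∑' x : Set.Ioi (0 : ℝ),
                zetaTerm (fun k => β ^ k) d s x * upperGamma s ((x : ℝ) * (β ^ c)⁻¹)) -
            (β : ℂ) ^ (-(c : ℂ) * s) / Complex.Gamma (s + 1) +
            1 / Complex.Gamma s * ∑' l : ℕ, mellinTerm β d c s l) ∧
      -- the singularities are at most simple poles, with the given residues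
      (∀ (j : ℕ) (k : ℤ),
        -1 ≤ meromorphicOrderAt Z (polePoint β d j k) ∧
        Filter.Tendsto (fun s => (s - polePoint β d j k) * Z s)
          (nhdsWithin (polePoint β d j k) {polePoint β d j k}ᶜ)
          (nhds (taylorCoeff β d j / Complex.Gamma (polePoint β d j k) *
            ∫ u in (0 : ℝ)..1, (Real.exp (periodicP β d u) : ℂ) *
              Complex.exp (-2 * Real.pi * Complex.I * k * u)))) ∧
      -- the values at the nonpositive integers
      (∀ n : ℕ, AnalyticAt ℂ Z (-(n : ℂ))) ∧
      ((∀ m : ℕ, Real.logb β d.card ≠ m) →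
        Z 0 = -1 ∧ ∀ n : ℕ, 1 ≤ n → Z (-(n : ℂ)) = 0) ∧
      (∀ m : ℕ, Real.logb β d.card = m → ∀ n : ℕ,
        Z (-(n : ℂ)) =
          (-1) ^ n * (n.factorial : ℂ) * taylorCoeff β d (n + m) *
              (∫ u in (0 : ℝ)..1, (Real.exp (periodicP β d u) : ℂ)) -
            (if n = 0 then 1 else 0)) := by
  have hd : IsDigitSet d := ⟨hd0, hdnn, hd2⟩
  have hterm : ∀ (s : ℂ) (x : Set.Ioi (0 : ℝ)), zetaTerm (fun k => β ^ k) d s x =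
      (repCount (fun k => β ^ k) d x : ℂ) * (1 / ((x : ℝ) : ℂ) ^ s) := fun s x => by
    rw [zetaTerm, mul_one_div]
  have hreg : ∀ n : ℕ, -(n : ℂ) ∈ regularSet β d →
      zetaMero β d (-(n : ℂ)) = -(if n = 0 then 1 else 0) := fun n hn => by
    rw [zetaMero_eq hd hβ le_rfl hn, zetaCont_eq, zetaEntire_neg_nat,
      Complex.Gamma_neg_nat_eq_zero, inv_zero, zero_mul, add_zero]
  have hpole : ∀ n : ℕ, -(n : ℂ) ∉ regularSet β d →
      ∃ j : ℕ, (β : ℂ) ^ (-(n : ℂ) + j - (Real.logb β d.card : ℂ)) = 1 := fun n hn => by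
    by_contra! h
    exact hn h
  refine ⟨zetaMero β d, ?_, ?_, ?_, ?_, ?_, ?_, ?_, ?_⟩
  · intro s
    by_cases hs : s ∈ regularSet β d
    · exact (analyticAt_zetaMero hd hβ hs).meromorphicAt
    · obtain ⟨j, hj⟩ : ∃ j : ℕ, (β : ℂ) ^ (s + j - (Real.logb β d.card : ℂ)) = 1 := by
        by_contra! h
        exact hs h
      exact (tendsto_sub_mul_zetaMero hd hβ hj).2.1
  · intro s hs
    rw [zetaMero_eq hd hβ le_rfl (mem_regularSet_of_lt hβ hs), zetaCont_eq_zetaSum hd hβ le_rfl hs]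
    simp only [hterm]
    exact hasSum_repCount hd hβ (f := fun x => 1 / (x : ℂ) ^ s) (hasSum_zetaSum hd hβ hs)
  · intro s hs
    exact analyticAt_zetaMero hd hβ ((mem_regularSet_iff hβ s).2 hs)
  · intro c hc s hs
    have hε0 : 0 < (β ^ c)⁻¹ := by positivity
    have h1 : HasSum (fun x : Set.Ioi (0 : ℝ) =>
        zetaTerm (fun k => β ^ k) d s x * upperGamma s ((x : ℝ) * (β ^ c)⁻¹))
        (upperGammaSum β d (β ^ c)⁻¹ s) := by
      simp only [hterm, mul_assoc]
      exact hasSum_repCount hd hβ (f := fun x => 1 / (x : ℂ) ^ s * upperGamma s (x * (β ^ c)⁻¹))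
        (hasSum_upperGammaSum hd hβ hε0 (inv_le_one_of_one_le₀ (one_le_pow₀ hβ.le)) s)
    refine ⟨h1.summable, ?_, ?_⟩
    · simp only [mellinTerm_eq]
      exact summable_mellinSeries hd hβ hc (fun _ => le_rfl) s
    · rw [h1.tsum_eq, zetaMero_eq hd hβ hc ((mem_regularSet_iff hβ s).2 hs), zetaCont, mellinSeries]
      simp only [mellinTerm_eq]
  · intro j k
    have hp := (cpow_eq_one_iff hβ (polePoint β d j k) j (d := d)).2 ⟨k, rfl⟩
    obtain ⟨h1, -, h2⟩ := tendsto_sub_mul_zetaMero hd hβ hp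
    refine ⟨h1, ?_⟩
    convert! h2 using 3
    -- At p_{j,k} one has z = -2πik/log β, so β^{zu} is the Fourier character.
    refine intervalIntegral.integral_congr fun u _ => ?_
    have hlog : (Real.log β : ℂ) ≠ 0 := by exact_mod_cast (Real.log_pos hβ).ne'
    rw [Complex.cpow_def_of_ne_zero (ofReal_ne_zero_of_one_lt hβ), ← Complex.ofReal_log
      (by linarith), polePoint]
    congr 2
    field_simp
    ring
  · intro n
    by_cases hn : -(n : ℂ) ∈ regularSet β d
    · exact analyticAt_zetaMero hd hβ hn
    · obtain ⟨j, hj⟩ := hpole n hn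
      exact (zetaMero_neg_nat_of_pole hd hβ hj).1
  · intro hD
    -- A possible pole at -n would give D = j - n, a natural number because D > 0.
    have hmem : ∀ n : ℕ, -(n : ℂ) ∈ regularSet β d := by
      intro n
      by_contra hn
      obtain ⟨j, hj⟩ := hpole n hn
      have h1 := congrArg norm hj
      rw [Complex.norm_cpow_eq_rpow_re_of_pos (by linarith), norm_one, ← Real.rpow_zero β] at h1
      have h2 := (Real.strictMono_rpow_of_base_gt_one hβ).injective h1
      simp only [Complex.sub_re, Complex.add_re, Complex.neg_re, Complex.natCast_re,
        Complex.ofReal_re] at h2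
      have h3 := DigitSeq.logb_card_pos hd hβ
      have h4 : n ≤ j := by exact_mod_cast (by linarith : (n : ℝ) ≤ j)
      refine hD (j - n) ?_
      rw [Nat.cast_sub h4]
      linarith
    refine ⟨by simpa using hreg 0 (hmem 0), fun n hn => ?_⟩
    rw [hreg n (hmem n), if_neg (by omega), neg_zero]
  · intro m hm n
    -- For D = m the point -n is p_{n+m,0}, where z = 0 and the power in the integrand is 1.
    have hz : -(n : ℂ) + ((n + m : ℕ) : ℂ) - (Real.logb β d.card : ℂ) = 0 := by
      rw [hm]
      push_cast
      ring
    have h := (zetaMero_neg_nat_of_pole hd hβ (n := n) (j := n + m) (d := d)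
      (by rw [hz, Complex.cpow_zero])).2
    rw [h, hz, periodIntegral]
    simp only [zero_mul, Complex.cpow_zero, mul_one]
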